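/- **Setting.** Let $m\ge 0$, let $X=\{x_0,x_1,\dots,x_m\}$ be an alphabet of noncommuting letters, $X^*$ the set of words, $\mathbf 1$ the empty word, $|\eta|$ the length of $\eta$. Let $\mathbb R\langle\langle X\rangle\rangle$ be the formal power series $c=\sum_\eta c(\eta)\eta$, with shuffle product $⧢$, and let $\mathbb R^m\langle\langle X\rangle\rangle$ be the $m$-tuples $c=(c_1,\dots,c_m)$ with the componentwise shuffle product. For $d\in\mathbb R^m\langle\langle X\rangle\rangle$ and words put $$\mathbf 1\curvearrowleft d=\mathbf 1,\qquad x_0\eta\curvearrowleft d=x_0(\eta\curvearrowleft d),\qquad x_i\eta\curvearrowleft d=x_i\big(d_i ⧢ (\eta\curvearrowleft d)\big)\quad(1\le i\le m),$$ extended to series by $(c\curvearrowleft d)_j=\sum_\eta c_j(\eta)\,(\eta\curvearrowleft d)$, and put $c\star d=d ⧢ (c\curvearrowleft d)$. Let $\mathcal B$ be the free commutative $\mathbb R$-algebra on the coordinate functions $a^j_\eta$ ($1\le j\le m$, $\eta\in X^*$), $a^j_\eta(c)=c_j(\eta)$, graded by $\deg a^j_\eta=|\eta|$; for $h\in\mathcal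 B\otimes\mathcal B$ write $h(c\otimes d)$ for its value at $(c,d)$. Let $\nu:\mathcal B\to\mathbb R$ be the algebra map with $\nu(a^j_{\mathbf 1})=1$ and $\nu(a^j_\eta)=0$ for $\eta\ne\mathbf 1$. Let $\mathcal I$ be the ideal generated by $a^1_{\mathbf 1}-1,\dots,a^m_{\mathbf 1}-1$, and $\mathcal H=\mathcal B/\mathcal I$ with the induced grading. **Definitions.** A right graded comodule bialgebra $(A,\delta,\varepsilon_A)$ over a graded bialgebra $(C,\Delta,\varepsilon_C)$ with coaction $\rho$ (all algebras commutative, $\delta$, $\Delta$, $\rho$ and the counits algebra maps) is a graded bialgebra with a degree-preserving algebra map $\rho:A\to A\otimes C$ satisfying $$(\rho\otimes\mathrm{id})\rho=(\mathrm{id}\otimes\Delta)\rho,\qquad (\mathrm{id}\otimes\varepsilon_C)\rho=\mathrm{id},$$ $$(\delta\otimes\mathrm{id})\rho=m_{1,3,24}(\rho\otimes\rho)\delta,\qquad (\varepsilon_A\otimes\mathrm{id})\rho=\varepsilon_A(\cdot)\,1,$$ where $m_{1,3,24}(a\otimes c\otimes a'\otimes c')=a\otimes a'\otimes cc'$. It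 is a right graded comodule Hopf algebra if, moreover, $A$ and $C$ are graded Hopf algebras, with degree-preserving antipodes, and the antipode $S$ of $A$ is a comodule morphism, $\rho S=(S\otimes\mathrm{id})\rho$. **Theorem.** There are unique algebra maps $\Delta_{⧢},\Delta,\rho:\mathcal B\to\mathcal B\otimes\mathcal B$ such that for all $j$, $\eta$, $c$, $d$ $$\Delta_{⧢}(a^j_\eta)(c\otimes d)=(c ⧢ d)_j(\eta),\qquad \Delta(a^j_\eta)(c\otimes d)=(c\star d)_j(\eta),\qquad \rho(a^j_\eta)(c\otimes d)=(c\curvearrowleft d)_j(\eta).$$ (1) $(\mathcal B,\Delta_{⧢},\nu)$ is a right graded comodule bialgebra over $(\mathcal B,\Delta,\nu)$ with coaction $\rho$. (2) $\Delta_{⧢},\Delta,\rho$ and $\nu$ induce unique algebra maps $\mathcal H\to\mathcal H\otimes\mathcal H$ and $\mathcal H\to\mathbb R$ on the quotient (denoted by the same symbols), $\mathcal H$ is connected ($\mathcal H_0=\mathbb R 1$), and $(\mathcal H,\Delta_{⧢},\nu)$ is a right graded comodule Hopf algebra over the graded Hopf algebra $(\mathcal H,\Delta,\nu)$ with coaction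 $\rho$; so the two form a cointeracting pair of graded connected Hopf algebras. -/

import Mathlib

open scoped TensorProduct

namespace MultFeedback

/-! ## Graded bialgebras, comodule bialgebras, comodule Hopf algebras

A commutative bialgebra is given by a commutative algebra with two algebra maps `Δ` and `ε`. -/

section Structures

variable {R A C : Type*} [CommRing R] [CommRing A] [Algebra R A] [CommRing C] [Algebra R C]

/-- The degree `n` part `⨁_{i+j=n} 𝒜 i ⊗ 𝒞 j` of the tensor product of two graded modules. -/
def tensorDegree (𝒜 : ℕ → Submodule R A) (𝒞 : ℕ → Submodule R C) (n : ℕ) :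
    Submodule R (A ⊗[R] C) :=
  ⨆ (i : ℕ) (j : ℕ) (_ : i + j = n),
    LinearMap.range (TensorProduct.map (𝒜 i).subtype (𝒞 j).subtype)

/-- `𝒜` makes the algebra `A` a graded algebra. -/
structure IsAlgebraGrading (𝒜 : ℕ → Submodule R A) : Prop where
  isInternal : DirectSum.IsInternal 𝒜
  gradedMonoid : SetLike.GradedMonoid 𝒜

/-- `(A, Δ, ε)` is a bialgebra; the fields are the hypotheses of `Bialgebra.ofAlgHom`. -/
structure IsBialgebra (Δ : A →ₐ[R] A ⊗[R] A) (ε : A →ₐ[R] R) : Prop where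
  coassoc : (Algebra.TensorProduct.assoc R R R A A A).toAlgHom.comp
      ((Algebra.TensorProduct.map Δ (.id R A)).comp Δ)
      = (Algebra.TensorProduct.map (.id R A) Δ).comp Δ
  counit_left : (Algebra.TensorProduct.map ε (.id R A)).comp Δ
      = (Algebra.TensorProduct.lid R A).symm
  counit_right : (Algebra.TensorProduct.map (.id R A) ε).comp Δ
      = (Algebra.TensorProduct.rid R R A).symm

/-- `(A, Δ, ε)` is a graded bialgebra for the grading `𝒜`. -/
structure IsGradedBialgebra (𝒜 : ℕ → Submodule R A)
    (Δ : A →ₐ[R] A ⊗[R] A) (ε : A →ₐ[R] R) : Prop extends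
    IsAlgebraGrading 𝒜, IsBialgebra Δ ε where
  comul_mem : ∀ n, ∀ x ∈ 𝒜 n, Δ x ∈ tensorDegree 𝒜 𝒜 n
  counit_eq_zero : ∀ n, n ≠ 0 → ∀ x ∈ 𝒜 n, ε x = 0

/-- `S` is an antipode of the bialgebra `(A, Δ, ε)`. -/
structure IsAntipode (Δ : A →ₐ[R] A ⊗[R] A) (ε : A →ₐ[R] R) (S : A →ₗ[R] A) : Prop where
  left : LinearMap.mul' R A ∘ₗ S.rTensor A ∘ₗ Δ.toLinearMap
      = Algebra.linearMap R A ∘ₗ ε.toLinearMap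
  right : LinearMap.mul' R A ∘ₗ S.lTensor A ∘ₗ Δ.toLinearMap
      = Algebra.linearMap R A ∘ₗ ε.toLinearMap

/-- `(A, Δ, ε)` is a graded Hopf algebra: a graded bialgebra with an antipode of degree `0`. -/
structure IsGradedHopfAlgebra (𝒜 : ℕ → Submodule R A)
    (Δ : A →ₐ[R] A ⊗[R] A) (ε : A →ₐ[R] R) : Prop extends IsGradedBialgebra 𝒜 Δ ε where
  exists_antipode : ∃ S : A →ₗ[R] A, IsAntipode Δ ε S ∧ ∀ n, ∀ x ∈ 𝒜 n, S x ∈ 𝒜 n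

/-- `ρ` is a right coaction on `A` of the bialgebra `(C, Δ, ε)`:
`(ρ ⊗ id) ∘ ρ = (id ⊗ Δ) ∘ ρ` and `(id ⊗ ε) ∘ ρ = id`. -/
structure IsRightCoaction (Δ : C →ₐ[R] C ⊗[R] C) (ε : C →ₐ[R] R)
    (ρ : A →ₐ[R] A ⊗[R] C) : Prop where
  coassoc : (Algebra.TensorProduct.assoc R R R A C C).toAlgHom.comp
      ((Algebra.TensorProduct.map ρ (.id R C)).comp ρ)
      = (Algebra.TensorProduct.map (.id R A) Δ).comp ρ
  counit : (Algebra.TensorProduct.map (.id R A) ε).comp ρ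
      = (Algebra.TensorProduct.rid R R A).symm

/-- `a ⊗ c ⊗ a' ⊗ c' ↦ a ⊗ a' ⊗ c c'`; composed with `ρ ⊗ ρ` this is the coaction on `A ⊗ A`. -/
noncomputable def mulRightLegs (R A C : Type*) [CommRing R] [CommRing A] [Algebra R A]
    [CommRing C] [Algebra R C] :
    (A ⊗[R] C) ⊗[R] (A ⊗[R] C) →ₐ[R] (A ⊗[R] A) ⊗[R] C :=
  (Algebra.TensorProduct.map (.id R (A ⊗[R] A)) (Algebra.TensorProduct.lmul' R)).comp
    (Algebra.TensorProduct.tensorTensorTensorComm R R R R A C A C).toAlgHom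

/-- `(A, δ, εA)` is a right graded comodule bialgebra over `(C, Δ, εC)` with coaction `ρ`:
a bialgebra in the category of graded right `C`-comodules. The product and the unit of `A` are
comodule morphisms because `ρ` is an algebra map. -/
structure IsRightGradedComoduleBialgebra (𝒜 : ℕ → Submodule R A) (𝒞 : ℕ → Submodule R C)
    (δ : A →ₐ[R] A ⊗[R] A) (εA : A →ₐ[R] R) (Δ : C →ₐ[R] C ⊗[R] C) (εC : C →ₐ[R] R)
    (ρ : A →ₐ[R] A ⊗[R] C) : Prop where
  bialgebra : IsGradedBialgebra 𝒜 δ εA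
  bialgebra_coacting : IsGradedBialgebra 𝒞 Δ εC
  coaction : IsRightCoaction Δ εC ρ
  coaction_mem : ∀ n, ∀ x ∈ 𝒜 n, ρ x ∈ tensorDegree 𝒜 𝒞 n
  comul_comodule : (Algebra.TensorProduct.map δ (.id R C)).comp ρ
      = (mulRightLegs R A C).comp ((Algebra.TensorProduct.map ρ ρ).comp δ)
  counit_comodule : ∀ x, Algebra.TensorProduct.map εA (.id R C) (ρ x) = εA x ⊗ₜ[R] (1 : C)

/-- `(A, δ, εA)` is a right graded comodule Hopf algebra over the graded Hopf algebra
`(C, Δ, εC)` with coaction `ρ`: a comodule bialgebra for which both bialgebras are Hopf algebras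
and the antipode of `A` is a morphism of graded comodules. -/
structure IsRightGradedComoduleHopfAlgebra (𝒜 : ℕ → Submodule R A) (𝒞 : ℕ → Submodule R C)
    (δ : A →ₐ[R] A ⊗[R] A) (εA : A →ₐ[R] R) (Δ : C →ₐ[R] C ⊗[R] C) (εC : C →ₐ[R] R)
    (ρ : A →ₐ[R] A ⊗[R] C) : Prop extends
    IsRightGradedComoduleBialgebra 𝒜 𝒞 δ εA Δ εC ρ where
  hopf_coacting : IsGradedHopfAlgebra 𝒞 Δ εC
  exists_antipode : ∃ S : A →ₗ[R] A, IsAntipode δ εA S ∧ (∀ n, ∀ x ∈ 𝒜 n, S x ∈ 𝒜 n) ∧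
    ρ.toLinearMap ∘ₗ S = S.rTensor C ∘ₗ ρ.toLinearMap

end Structures

/-! ## Formal power series in the noncommuting letters `x_0, …, x_m` -/

/-- Words in `x_0, …, x_m`. -/
abbrev Word (m : ℕ) := List (Fin (m + 1))

/-- `ℝ⟨⟨X⟩⟩`: a series is the family of its coefficients. -/
abbrev Series (m : ℕ) := Word m → ℝ

/-- `ℝ^m⟨⟨X⟩⟩`. -/
abbrev VSeries (m : ℕ) := Fin m → Series m

/-- The terms, with multiplicity, of the unshuffle coproduct of a word: the algebra map for
catenation with `x_i ↦ x_i ⊗ 1 + 1 ⊗ x_i`. -/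
def unshuffle {m : ℕ} : Word m → List (Word m × Word m)
  | [] => [([], [])]
  | x :: w => (unshuffle w).map (fun p => (x :: p.1, p.2)) ++
      (unshuffle w).map (fun p => (p.1, x :: p.2))

/-- The shuffle product of two series. -/
noncomputable def shuffle {m : ℕ} (c d : Series m) : Series m := fun η =>
  ((unshuffle η).map (fun p => c p.1 * d p.2)).sum

/-- The shuffle product on `ℝ^m⟨⟨X⟩⟩`, componentwise. -/
noncomputable def vshuffle {m : ℕ} (c d : VSeries m) : VSeries m := fun j => shuffle (c j) (d j)

/-- Left catenation `x s` of a letter and a series. -/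
def consSeries {m : ℕ} (x : Fin (m + 1)) (s : Series m) : Series m
  | [] => 0
  | y :: w => if y = x then s w else 0

/-- `η ↶ d` for a word `η`: `1 ↶ d = 1`, `x_0 η ↶ d = x_0 (η ↶ d)`, and
`x_i η ↶ d = x_i (d_i ш (η ↶ d))` for `i = 1, …, m`. The letter `x_i` is `i.succ` when `d_i` is the
component of `d` with index `i : Fin m`. -/
noncomputable def wordMix {m : ℕ} (d : VSeries m) : Word m → Series m
  | [] => fun ξ => if ξ = [] then 1 else 0
  | x :: η => consSeries x
      (Fin.cases (motive := fun _ => Series m) (wordMix d η)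
        (fun i => shuffle (d i) (wordMix d η)) x)

/-- `c ↶ d = ∑_η c(η) (η ↶ d)` for a scalar series `c`; each coefficient is a finite sum, see
`wordMix_support_finite`. -/
noncomputable def mix {m : ℕ} (c : Series m) (d : VSeries m) : Series m := fun ξ =>
  ∑ᶠ η : Word m, c η * wordMix d η ξ

/-- The multiplicative mixed composition product `c ↶ d`. -/
noncomputable def vmix {m : ℕ} (c d : VSeries m) : VSeries m := fun j => mix (c j) d

/-- The multiplicative composition product `c ⋆ d = d ш (c ↶ d)`. -/
noncomputable def star {m : ℕ} (c d : VSeries m) : VSeries m := vshuffle d (vmix c d)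

theorem length_of_mem_unshuffle {m : ℕ} (w : Word m) (p : Word m × Word m)
    (hp : p ∈ unshuffle w) : p.1.length + p.2.length = w.length := by
  induction w generalizing p with
  | nil => simp [unshuffle] at hp; simp [hp]
  | cons x w ih =>
    simp only [unshuffle, List.mem_append, List.mem_map] at hp
    rcases hp with ⟨q, hq, rfl⟩ | ⟨q, hq, rfl⟩ <;> have := ih q hq <;> simp <;> omega

theorem wordMix_eq_zero {m : ℕ} (d : VSeries m) (η ξ : Word m) (h : ξ.length < η.length) :
    wordMix d η ξ = 0 := by
  induction η generalizing ξ with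
  | nil => simp at h
  | cons x η ih =>
    cases ξ with
    | nil => simp [wordMix, consSeries]
    | cons y w =>
      have hw : w.length < η.length := by simpa using h
      simp only [wordMix, consSeries]
      split_ifs with hy
      · induction x using Fin.cases with
        | zero => exact ih w hw
        | succ i =>
          simp only [Fin.cases_succ, shuffle]
          apply List.sum_eq_zero
          intro r hr
          obtain ⟨p, hp, rfl⟩ := List.mem_map.1 hr
          have := length_of_mem_unshuffle w p hp
          rw [ih p.2 (by omega), mul_zero]
      · rfl

/-- The sum defining each coefficient of `c ↶ d` is finite. -/
theorem wordMix_support_finite {m : ℕ} (c : Series m) (d : VSeries m) (ξ : Word m) :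
    (Function.support fun η : Word m => c η * wordMix d η ξ).Finite := by
  refine (List.finite_length_le (Fin (m + 1)) ξ.length).subset fun η hη => ?_
  by_contra hlt
  exact hη (by simp [wordMix_eq_zero d η ξ (by simpa using hlt)])

/-! ## The algebras `𝓑` and `𝓗` -/

/-- `𝓑`: the symmetric algebra on the space with basis the coordinate functions `a^j_η`. -/
abbrev B (m : ℕ) := MvPolynomial (Fin m × Word m) ℝ

/-- The coordinate function `a^j_η`. -/
noncomputable def coord {m : ℕ} (j : Fin m) (η : Word m) : B m := MvPolynomial.X (j, η)

/-- The grading of `𝓑` in which `a^j_η` has degree `|η|`. -/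
noncomputable def gradeB (m : ℕ) : ℕ → Submodule ℝ (B m) :=
  MvPolynomial.weightedHomogeneousSubmodule ℝ fun p => p.2.length

/-- The counit `ν` of `𝓑`: the algebra map with `ν(a^j_η) = 1` if `η` is empty, `0` otherwise. -/
noncomputable def counitB (m : ℕ) : B m →ₐ[ℝ] ℝ :=
  MvPolynomial.aeval fun p => if p.2 = [] then 1 else 0

/-- The value of an element of `𝓑` at a series. -/
noncomputable def evalAt {m : ℕ} (c : VSeries m) : B m →ₐ[ℝ] ℝ :=
  MvPolynomial.aeval fun p => c p.1 p.2

/-- The value of an element of `𝓑 ⊗ 𝓑` at `c ⊗ d`. -/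
noncomputable def evalAt₂ {m : ℕ} (c d : VSeries m) : B m ⊗[ℝ] B m →ₐ[ℝ] ℝ :=
  (Algebra.TensorProduct.lmul' ℝ).comp (Algebra.TensorProduct.map (evalAt c) (evalAt d))

/-- The algebra map `f : 𝓑 → 𝓑 ⊗ 𝓑` is dual to the operation `op` on series:
`f(a^j_η)(c ⊗ d) = (op c d)_j(η)`. -/
def IsDualTo {m : ℕ} (f : B m →ₐ[ℝ] B m ⊗[ℝ] B m) (op : VSeries m → VSeries m → VSeries m) :
    Prop :=
  ∀ (j : Fin m) (η : Word m) (c d : VSeries m), evalAt₂ c d (f (coord j η)) = op c d j η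

/-- The ideal of `𝓑` generated by the elements `a^i_1 - 1`, with `1` the empty word. -/
noncomputable def idealI (m : ℕ) : Ideal (B m) :=
  Ideal.span (Set.range fun i : Fin m => coord i [] - 1)

/-- The quotient algebra `𝓗`. -/
abbrev H (m : ℕ) := B m ⧸ idealI m

/-- The quotient map `𝓑 → 𝓗`. -/
noncomputable def proj (m : ℕ) : B m →ₐ[ℝ] H m := Ideal.Quotient.mkₐ ℝ (idealI m)

/-- The grading of `𝓗` induced by that of `𝓑`. -/
noncomputable def gradeH (m : ℕ) (n : ℕ) : Submodule ℝ (H m) :=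
  (gradeB m n).map (proj m).toLinearMap

/-- `g : 𝓗 → 𝓗 ⊗ 𝓗` is induced by `f : 𝓑 → 𝓑 ⊗ 𝓑` on the quotient. -/
def IsInducedBy {m : ℕ} (g : H m →ₐ[ℝ] H m ⊗[ℝ] H m) (f : B m →ₐ[ℝ] B m ⊗[ℝ] B m) : Prop :=
  g.comp (proj m) = (Algebra.TensorProduct.map (proj m) (proj m)).comp f

end MultFeedback

/-!
A series is a point of `𝓑`, and a series with constant coefficients `1` is a point of `𝓗`: the
evaluations at these points separate the elements of `𝓑` (a real polynomial that vanishes everywhere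
is zero) and of `𝓗`, and the evaluations at pairs and triples of points separate the elements of the
tensor powers (`Separates.pairEval`). Each axiom of a comodule bialgebra is an equality of algebra
maps into such a tensor power, and its value at points is an identity between the operations on
series:

* the shuffle product and `⋆` are associative with unit `1`, for the coassociativity and the counit
  of the two coproducts;
* `(c ↶ d) ↶ e = c ↶ (d ⋆ e)` and `c ↶ 1 = c`, for the coaction (`vmix_vmix`, `vmix_vone`);
* `(c ш c') ↶ d = (c ↶ d) ш (c' ↶ d)` and `1 ↶ d = 1`, for the compatibility of the coaction with
  the coproduct and the counit (`vshuffle_vmix`, `vone_vmix`).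

These follow by induction on words from the behaviour under a left shift `x⁻¹` by a letter: it is a
derivation of the shuffle product, `x_0⁻¹ (c ↶ d) = (x_0⁻¹ c) ↶ d`, and
`x_i⁻¹ (c ↶ d) = d_i ш ((x_i⁻¹ c) ↶ d)`. Associativity of `⋆` is a formal consequence.

The structure maps respect the gradings because they do so on the generators `a^j_η`. They descend to
`𝓗` because they send `a^j_1` to `a^j_1 ⊗ a^j_1` or `a^j_1 ⊗ 1`, and `𝓗` is graded because
`a^j_1 ↦ 1` defines a section of `𝓑 → 𝓗` that respects degrees.

In degree zero `𝓗` consists of scalars. For such a connected graded bialgebra `η ∘ ε - id` is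
locally nilpotent for the convolution product, so `id` has the convolution inverse
`∑ₖ (η ∘ ε - id)^{*k}`, a finite sum in each degree (`exists_antipode_of_connected`). Its terms are
convolution products of comodule morphisms, hence comodule morphisms (`isComoduleMap_conv`), and so
is the antipode.
-/

namespace MultFeedback

/-! ### Shuffle algebra of series -/

section Series

variable {m : ℕ}

/-- The left shift `x⁻¹ c` of a series by a letter; it is a derivation of the shuffle product. -/
def leftShift (x : Fin (m + 1)) (c : Series m) : Series m := fun w => c (x :: w)

/-- The series `1`, with the empty word as its only term. -/
def oneSeries (m : ℕ) : Series m := fun w => if w = [] then 1 else 0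

theorem leftShift_oneSeries (x : Fin (m + 1)) : leftShift x (oneSeries m) = 0 := by
  funext w; simp [leftShift, oneSeries]

theorem shuffle_nil (c d : Series m) : shuffle c d [] = c [] * d [] := by
  simp [shuffle, unshuffle]

theorem shuffle_cons (c d : Series m) (x : Fin (m + 1)) (w : Word m) :
    shuffle c d (x :: w) = shuffle (leftShift x c) d w + shuffle c (leftShift x d) w := by
  simp [shuffle, unshuffle, leftShift, Function.comp_def]

theorem leftShift_shuffle (x : Fin (m + 1)) (c d : Series m) :
    leftShift x (shuffle c d) = shuffle (leftShift x c) d + shuffle c (leftShift x d) :=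
  funext fun w => shuffle_cons c d x w

theorem shuffle_add (c d e : Series m) : shuffle c (d + e) = shuffle c d + shuffle c e := by
  funext w
  simp [shuffle, mul_add, List.sum_map_add]

theorem add_shuffle (c d e : Series m) : shuffle (c + d) e = shuffle c e + shuffle d e := by
  funext w
  simp [shuffle, add_mul, List.sum_map_add]

theorem shuffle_zero (c : Series m) : shuffle c 0 = 0 := by
  funext w; simp [shuffle]

theorem shuffle_comm (c d : Series m) : shuffle c d = shuffle d c := by
  funext w
  induction w generalizing c d with
  | nil => rw [shuffle_nil, shuffle_nil, mul_comm]
  | cons x w ih => rw [shuffle_cons, shuffle_cons, ih, ih c, add_comm]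

theorem shuffle_assoc (c d e : Series m) :
    shuffle (shuffle c d) e = shuffle c (shuffle d e) := by
  funext w
  induction w generalizing c d e with
  | nil => simp only [shuffle_nil, mul_assoc]
  | cons x w ih =>
    simp only [shuffle_cons, leftShift_shuffle, shuffle_add, add_shuffle, Pi.add_apply, ih,
      add_assoc]

theorem shuffle_oneSeries (c : Series m) : shuffle c (oneSeries m) = c := by
  funext w
  induction w generalizing c with
  | nil => simp [shuffle_nil, oneSeries]
  | cons x w ih => rw [shuffle_cons, ih, leftShift_oneSeries, shuffle_zero]; simp [leftShift]

/-- A coefficient of `c ш d` at a word `w` depends only on the coefficients of `d` at words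
that are not longer than `w`. -/
theorem shuffle_congr_right {c d d' : Series m} {w : Word m}
    (h : ∀ v : Word m, v.length ≤ w.length → d v = d' v) : shuffle c d w = shuffle c d' w := by
  unfold shuffle
  refine congrArg List.sum (List.map_congr_left fun p hp => ?_)
  rw [h p.2 (by have := length_of_mem_unshuffle w p hp; omega)]

/-! ### The mixed composition product of series -/

theorem mix_nil (c : Series m) (d : VSeries m) : mix c d [] = c [] := by
  rw [mix, finsum_eq_single _ ([] : Word m)]
  · simp [wordMix]
  · intro η hη
    rw [wordMix_eq_zero d η [] (List.length_pos_iff.2 hη), mul_zero]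

theorem wordMix_cons_cons (d : VSeries m) (x y : Fin (m + 1)) (η w : Word m) :
    wordMix d (y :: η) (x :: w) = if x = y then
      (Fin.cases (motive := fun _ => Series m) (wordMix d η)
        (fun i => shuffle (d i) (wordMix d η)) x) w else 0 := by
  simp only [wordMix, consSeries]
  split_ifs with h
  · subst h; rfl
  · rfl

/-- In the sum over all words `η` that gives the coefficient of `c ↶ d` at `x w`, only the words
`η` with first letter `x` contribute. -/
theorem mix_cons (c : Series m) (d : VSeries m) (x : Fin (m + 1)) (w : Word m) :
    mix c d (x :: w) = ∑ᶠ η : Word m, leftShift x c η * wordMix d (x :: η) (x :: w) := by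
  have hinj : Function.Injective (fun η : Word m => x :: η) := List.cons_injective
  change _ = ∑ᶠ η : Word m, c (x :: η) * wordMix d (x :: η) (x :: w)
  rw [mix, ← finsum_mem_range (f := fun η => c η * wordMix d η (x :: w)) hinj,
    ← finsum_mem_univ]
  refine finsum_mem_inter_support_eq' _ _ _ fun η hη => ?_
  simp only [Set.mem_univ, Set.mem_range, true_iff]
  cases η with
  | nil => simp [wordMix] at hη
  | cons y η =>
    rw [Function.mem_support, wordMix_cons_cons] at hη
    by_cases h : x = y
    · exact ⟨η, by rw [h]⟩
    · simp [h] at hη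

theorem finsum_list_sum {ι α : Type*} (l : List ι) (f : ι → α → ℝ)
    (hf : ∀ i, (Function.support (f i)).Finite) :
    ∑ᶠ a, (l.map fun i => f i a).sum = (l.map fun i => ∑ᶠ a, f i a).sum := by
  have key : ∀ l : List ι, (Function.support fun a => (l.map fun i => f i a).sum).Finite ∧
      ∑ᶠ a, (l.map fun i => f i a).sum = (l.map fun i => ∑ᶠ a, f i a).sum := by
    intro l
    induction l with
    | nil => simp
    | cons i l ih =>
      simp only [List.map_cons, List.sum_cons]
      exact ⟨((hf i).union ih.1).subset (Function.support_add _ _),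
        by rw [finsum_add_distrib (hf i) ih.1, ih.2]⟩
  exact (key l).2

theorem mix_cons_zero (c : Series m) (d : VSeries m) (w : Word m) :
    mix c d (0 :: w) = mix (leftShift 0 c) d w := by
  rw [mix_cons, mix]
  simp [wordMix_cons_cons]

theorem mix_cons_succ (c : Series m) (d : VSeries m) (i : Fin m) (w : Word m) :
    mix c d (i.succ :: w) = shuffle (d i) (mix (leftShift i.succ c) d) w := by
  rw [mix_cons]
  simp only [wordMix_cons_cons, if_true, Fin.cases_succ]
  have hfin (u : Word m) := wordMix_support_finite (leftShift i.succ c) d u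
  simp only [shuffle, mix]
  have h1 (η : Word m) : leftShift i.succ c η *
      ((unshuffle w).map fun p => d i p.1 * wordMix d η p.2).sum =
      ((unshuffle w).map fun p => d i p.1 * (leftShift i.succ c η * wordMix d η p.2)).sum := by
    rw [← List.sum_map_mul_left]
    simp only [mul_left_comm]
  simp only [h1]
  rw [finsum_list_sum (unshuffle w)
    (fun p η => d i p.1 * (leftShift i.succ c η * wordMix d η p.2))
    fun p => (hfin p.2).subset (Function.support_mul_subset_right _ _)]
  refine congrArg List.sum (List.map_congr_left fun p _ => ?_)
  rw [mul_finsum]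

theorem leftShift_zero_mix (c : Series m) (d : VSeries m) :
    leftShift 0 (mix c d) = mix (leftShift 0 c) d := funext fun w => mix_cons_zero c d w

theorem leftShift_succ_mix (c : Series m) (d : VSeries m) (i : Fin m) :
    leftShift i.succ (mix c d) = shuffle (d i) (mix (leftShift i.succ c) d) :=
  funext fun w => mix_cons_succ c d i w

theorem add_mix (c c' : Series m) (d : VSeries m) : mix (c + c') d = mix c d + mix c' d := by
  funext w
  simp only [mix, Pi.add_apply, add_mul]
  exact finsum_add_distrib (wordMix_support_finite c d w) (wordMix_support_finite c' d w)

/-- Two families of series are equal if the equality of their coefficients at `x w` follows from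
that of all the coefficients at words not longer than `w`, for all members of the families. -/
theorem family_eq_of_cons {α : Sort*} (F G : α → Series m)
    (h0 : ∀ a, F a [] = G a [])
    (hcons : ∀ a x (w : Word m), (∀ b (v : Word m), v.length ≤ w.length → F b v = G b v) →
      F a (x :: w) = G a (x :: w)) (a : α) : F a = G a := by
  funext w
  induction h : w.length using Nat.strong_induction_on generalizing w a with
  | _ n ih =>
    cases w with
    | nil => exact h0 a
    | cons x w =>
      refine hcons a x w fun b v hv => ih v.length ?_ b v rfl
      simp at h; omega

/-- `c ↦ c ↶ d` is a homomorphism for the shuffle product. -/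
theorem shuffle_mix (c c' : Series m) (d : VSeries m) :
    mix (shuffle c c') d = shuffle (mix c d) (mix c' d) := by
  refine family_eq_of_cons (α := Series m × Series m) (fun p => mix (shuffle p.1 p.2) d)
    (fun p => shuffle (mix p.1 d) (mix p.2 d)) ?_ ?_ (c, c')
  · intro p; simp only [mix_nil, shuffle_nil]
  · rintro ⟨a, b⟩ x w ih
    have ih' (a b : Series m) (v : Word m) (hv : v.length ≤ w.length) := ih (a, b) v hv
    dsimp only at ih' ⊢
    induction x using Fin.cases with
    | zero =>
      rw [mix_cons_zero, leftShift_shuffle, add_mix, Pi.add_apply, ih' _ _ _ le_rfl,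
        ih' _ _ _ le_rfl, shuffle_cons, leftShift_zero_mix, leftShift_zero_mix]
    | succ i =>
      rw [mix_cons_succ, leftShift_shuffle, add_mix, shuffle_add, Pi.add_apply,
        shuffle_congr_right (ih' _ _), shuffle_congr_right (ih' _ _), shuffle_cons,
        leftShift_succ_mix, leftShift_succ_mix, shuffle_assoc,
        shuffle_comm (mix a d) (shuffle (d i) _), shuffle_assoc (d i), shuffle_comm _ (mix a d)]

theorem oneSeries_mix (d : VSeries m) : mix (oneSeries m) d = oneSeries m := by
  funext w
  have h0 : mix (0 : Series m) d = 0 := by funext w; simp [mix]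
  cases w with
  | nil => rw [mix_nil]
  | cons x w =>
    have hx : oneSeries m (x :: w) = 0 := by simp [oneSeries]
    induction x using Fin.cases with
    | zero => rw [mix_cons_zero, leftShift_oneSeries, h0, hx]; rfl
    | succ i => rw [mix_cons_succ, leftShift_oneSeries, h0, shuffle_zero, hx]; rfl

theorem mix_oneSeries (c : Series m) : mix c (fun _ => oneSeries m) = c := by
  funext w
  induction w generalizing c with
  | nil => rw [mix_nil]
  | cons x w ih =>
    induction x using Fin.cases with
    | zero => rw [mix_cons_zero, ih]; rfl
    | succ i => rw [mix_cons_succ, shuffle_comm, shuffle_oneSeries, ih]; rfl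

/-- `↶` is a right action of the semigroup of `⋆`. -/
theorem mix_mix (c : Series m) (d e : VSeries m) : mix (mix c d) e = mix c (star d e) := by
  refine family_eq_of_cons (fun c => mix (mix c d) e) (fun c => mix c (star d e)) ?_ ?_ c
  · intro c; simp only [mix_nil]
  · intro c x w ih
    induction x using Fin.cases with
    | zero => rw [mix_cons_zero, leftShift_zero_mix, ih _ _ le_rfl, mix_cons_zero]
    | succ i =>
      rw [mix_cons_succ, leftShift_succ_mix, shuffle_mix, ← shuffle_assoc,
        shuffle_congr_right (ih _), mix_cons_succ]
      rfl

/-! ### The operations on `ℝ^m⟨⟨X⟩⟩` -/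

/-- The unit `(1, …, 1)` of `ℝ^m⟨⟨X⟩⟩`. -/
def vone (m : ℕ) : VSeries m := fun _ => oneSeries m

theorem vshuffle_comm (c d : VSeries m) : vshuffle c d = vshuffle d c :=
  funext fun j => shuffle_comm (c j) (d j)

theorem vshuffle_assoc (c d e : VSeries m) :
    vshuffle (vshuffle c d) e = vshuffle c (vshuffle d e) :=
  funext fun j => shuffle_assoc (c j) (d j) (e j)

theorem vshuffle_vone (c : VSeries m) : vshuffle c (vone m) = c :=
  funext fun j => shuffle_oneSeries (c j)

theorem vone_vshuffle (c : VSeries m) : vshuffle (vone m) c = c := by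
  rw [vshuffle_comm, vshuffle_vone]

theorem vmix_vmix (c d e : VSeries m) : vmix (vmix c d) e = vmix c (star d e) :=
  funext fun j => mix_mix (c j) d e

theorem vshuffle_vmix (c c' d : VSeries m) :
    vmix (vshuffle c c') d = vshuffle (vmix c d) (vmix c' d) :=
  funext fun j => shuffle_mix (c j) (c' j) d

theorem vone_vmix (d : VSeries m) : vmix (vone m) d = vone m :=
  funext fun _ => oneSeries_mix d

theorem vmix_vone (c : VSeries m) : vmix c (vone m) = c :=
  funext fun j => mix_oneSeries (c j)

theorem star_assoc (c d e : VSeries m) : star (star c d) e = star c (star d e) := by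
  rw [star, star, vshuffle_vmix, vmix_vmix, ← vshuffle_assoc]
  rfl

theorem star_vone (c : VSeries m) : star c (vone m) = c := by
  rw [star, vmix_vone, vone_vshuffle]

theorem vone_star (c : VSeries m) : star (vone m) c = c := by
  rw [star, vone_vmix, vshuffle_vone]

end Series

/-! ### The grading of a tensor product -/

section TensorDegree

variable {R A C A' C' : Type*} [CommRing R] [CommRing A] [Algebra R A] [CommRing C] [Algebra R C]
  [CommRing A'] [Algebra R A'] [CommRing C'] [Algebra R C']
  {𝒜 : ℕ → Submodule R A} {𝒞 : ℕ → Submodule R C}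
  {𝒜' : ℕ → Submodule R A'} {𝒞' : ℕ → Submodule R C'}

theorem tmul_mem_tensorDegree {i j n : ℕ} (h : i + j = n) {a : A} {c : C} (ha : a ∈ 𝒜 i)
    (hc : c ∈ 𝒞 j) : a ⊗ₜ[R] c ∈ tensorDegree 𝒜 𝒞 n := by
  have : LinearMap.range (TensorProduct.map (𝒜 i).subtype (𝒞 j).subtype) ≤
      tensorDegree 𝒜 𝒞 n := le_iSup_of_le i (le_iSup_of_le j (le_iSup_of_le h le_rfl))
  exact this ⟨⟨a, ha⟩ ⊗ₜ ⟨c, hc⟩, rfl⟩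

theorem tensorDegree_le {n : ℕ} {N : Submodule R (A ⊗[R] C)}
    (h : ∀ i j, i + j = n → ∀ a ∈ 𝒜 i, ∀ c ∈ 𝒞 j, a ⊗ₜ[R] c ∈ N) :
    tensorDegree 𝒜 𝒞 n ≤ N := by
  refine iSup_le fun i => iSup_le fun j => iSup_le fun hij => ?_
  rintro _ ⟨z, rfl⟩
  induction z with
  | zero => simp
  | add x y hx hy => rw [map_add]; exact add_mem hx hy
  | tmul a c => exact h i j hij a a.2 c c.2

theorem eq_of_mem_tensorDegree {M : Type*} [AddCommGroup M] [Module R M]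
    {f g : A ⊗[R] C →ₗ[R] M} {n : ℕ}
    (h : ∀ i j, i + j = n → ∀ a ∈ 𝒜 i, ∀ c ∈ 𝒞 j, f (a ⊗ₜ[R] c) = g (a ⊗ₜ[R] c))
    {x : A ⊗[R] C} (hx : x ∈ tensorDegree 𝒜 𝒞 n) : f x = g x :=
  tensorDegree_le (N := LinearMap.eqLocus f g) h hx

theorem map_mem_tensorDegree (f : A →ₗ[R] A') (g : C →ₗ[R] C')
    (hf : ∀ n, ∀ a ∈ 𝒜 n, f a ∈ 𝒜' n) (hg : ∀ n, ∀ c ∈ 𝒞 n, g c ∈ 𝒞' n) {n : ℕ}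
    {x : A ⊗[R] C} (hx : x ∈ tensorDegree 𝒜 𝒞 n) :
    TensorProduct.map f g x ∈ tensorDegree 𝒜' 𝒞' n :=
  tensorDegree_le (N := (tensorDegree 𝒜' 𝒞' n).comap (TensorProduct.map f g))
    (fun i j h a ha c hc => tmul_mem_tensorDegree h (hf i a ha) (hg j c hc)) hx

theorem one_mem_tensorDegree [SetLike.GradedMonoid 𝒜] [SetLike.GradedMonoid 𝒞] :
    (1 : A ⊗[R] C) ∈ tensorDegree 𝒜 𝒞 0 :=
  tmul_mem_tensorDegree (add_zero 0) SetLike.GradedOne.one_mem SetLike.GradedOne.one_mem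

theorem mul_mem_tensorDegree [SetLike.GradedMonoid 𝒜] [SetLike.GradedMonoid 𝒞] {n k : ℕ}
    {x y : A ⊗[R] C} (hx : x ∈ tensorDegree 𝒜 𝒞 n) (hy : y ∈ tensorDegree 𝒜 𝒞 k) :
    x * y ∈ tensorDegree 𝒜 𝒞 (n + k) := by
  refine tensorDegree_le (N := (tensorDegree 𝒜 𝒞 (n + k)).comap (LinearMap.mulRight R y))
    (fun i j h a ha c hc => ?_) hx
  refine tensorDegree_le (N := (tensorDegree 𝒜 𝒞 (n + k)).comap
    (LinearMap.mulLeft R (a ⊗ₜ[R] c))) (fun i' j' h' a' ha' c' hc' => ?_) hy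
  rw [Submodule.mem_comap, LinearMap.mulLeft_apply, Algebra.TensorProduct.tmul_mul_tmul]
  exact tmul_mem_tensorDegree (by omega) (SetLike.GradedMul.mul_mem ha ha')
    (SetLike.GradedMul.mul_mem hc hc')

theorem mul'_mem_of_mem_tensorDegree [SetLike.GradedMonoid 𝒜] {n : ℕ} {x : A ⊗[R] A}
    (hx : x ∈ tensorDegree 𝒜 𝒜 n) : LinearMap.mul' R A x ∈ 𝒜 n :=
  tensorDegree_le (N := (𝒜 n).comap (LinearMap.mul' R A))
    (fun i j h a ha c hc => by
      subst h; simpa using SetLike.GradedMul.mul_mem ha hc) hx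

/-- Linear maps given on the pieces of a grading glue. -/
theorem exists_linearMap_of_isInternal (h : DirectSum.IsInternal 𝒜) (f : ℕ → A →ₗ[R] C) :
    ∃ S : A →ₗ[R] C, ∀ n, ∀ x ∈ 𝒜 n, S x = f n x := by
  let e := LinearEquiv.ofBijective (DirectSum.coeLinearMap 𝒜) h
  refine ⟨DirectSum.toModule R ℕ C (fun n => f n ∘ₗ (𝒜 n).subtype) ∘ₗ e.symm.toLinearMap,
    fun n x hx => ?_⟩
  have : e.symm x = DirectSum.lof R ℕ (fun n => 𝒜 n) n ⟨x, hx⟩ := by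
    rw [LinearEquiv.symm_apply_eq]
    exact (DirectSum.coeLinearMap_lof 𝒜 n ⟨x, hx⟩).symm
  simp [this]

theorem linearMap_ext_of_isInternal (h : DirectSum.IsInternal 𝒜) {M : Type*} [AddCommGroup M]
    [Module R M] {f g : A →ₗ[R] M} (hfg : ∀ n, ∀ x ∈ 𝒜 n, f x = g x) : f = g := by
  have htop : (⊤ : Submodule R A) ≤ LinearMap.eqLocus f g := by
    rw [← h.submodule_iSup_eq_top]
    exact iSup_le hfg
  exact LinearMap.ext fun x => htop (Submodule.mem_top (x := x))

end TensorDegree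

/-! ### The antipode of a graded connected bialgebra -/

section Antipode

variable {R A C : Type*} [CommRing R] [CommRing A] [Algebra R A] [CommRing C] [Algebra R C]
  {𝒜 : ℕ → Submodule R A} {𝒞 : ℕ → Submodule R C}
  {Δ : A →ₐ[R] A ⊗[R] A} {ε : A →ₐ[R] R}

/-- The coalgebra underlying a bialgebra. -/
abbrev IsBialgebra.coalgebra (h : IsBialgebra Δ ε) : Coalgebra R A where
  comul := Δ.toLinearMap
  counit := ε.toLinearMap
  coassoc := congrArg AlgHom.toLinearMap h.coassoc
  rTensor_counit_comp_comul := congrArg AlgHom.toLinearMap h.counit_left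
  lTensor_counit_comp_comul := congrArg AlgHom.toLinearMap h.counit_right

/-- The convolution product `f * g = mult ∘ (f ⊗ g) ∘ Δ` of linear endomorphisms. -/
noncomputable def conv (Δ : A →ₐ[R] A ⊗[R] A) (f g : A →ₗ[R] A) : A →ₗ[R] A :=
  LinearMap.mul' R A ∘ₗ TensorProduct.map f g ∘ₗ Δ.toLinearMap

/-- The unit `η ∘ ε` of the convolution product. -/
noncomputable def convUnit (ε : A →ₐ[R] R) : A →ₗ[R] A :=
  Algebra.linearMap R A ∘ₗ ε.toLinearMap

/-- The convolution powers of `η ∘ ε - id`. -/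
noncomputable def convPow (Δ : A →ₐ[R] A ⊗[R] A) (ε : A →ₐ[R] R) : ℕ → A →ₗ[R] A
  | 0 => convUnit ε
  | k + 1 => conv Δ (convPow Δ ε k) (convUnit ε - LinearMap.id)

/-- The partial sums of the geometric series `∑ₖ (η ∘ ε - id)^{*k}`, the convolution inverse of
`id = η ∘ ε - (η ∘ ε - id)`. -/
noncomputable def antipodeSum (Δ : A →ₐ[R] A ⊗[R] A) (ε : A →ₐ[R] R) (N : ℕ) : A →ₗ[R] A :=
  ∑ k ∈ Finset.range N, convPow Δ ε k

open WithConv in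
theorem conv_antipodeSum (h : IsBialgebra Δ ε) (N : ℕ) :
    conv Δ (antipodeSum Δ ε N) LinearMap.id = convUnit ε - convPow Δ ε N ∧
    conv Δ LinearMap.id (antipodeSum Δ ε N) = convUnit ε - convPow Δ ε N := by
  let _ := h.coalgebra
  have hpow (k : ℕ) : toConv (convPow Δ ε k) =
      (1 - toConv LinearMap.id : WithConv (A →ₗ[R] A)) ^ k := by
    induction k with
    | zero => rfl
    | succ k ih => rw [pow_succ, ← ih]; rfl
  have hsum : toConv (antipodeSum Δ ε N) =
      ∑ k ∈ Finset.range N, (1 - toConv LinearMap.id : WithConv (A →ₗ[R] A)) ^ k := by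
    simp only [← hpow]
    exact map_sum (WithConv.linearEquiv R (A →ₗ[R] A)).symm _ _
  constructor <;> apply toConv_injective
  · have := geom_sum_mul_neg (1 - toConv LinearMap.id : WithConv (A →ₗ[R] A)) N
    rw [← hsum, ← hpow, sub_sub_cancel] at this
    exact this
  · have := mul_neg_geom_sum (1 - toConv LinearMap.id : WithConv (A →ₗ[R] A)) N
    rw [← hsum, ← hpow, sub_sub_cancel] at this
    exact this

theorem convUnit_mem (h : IsGradedBialgebra 𝒜 Δ ε) (n : ℕ) (x : A) (hx : x ∈ 𝒜 n) :
    convUnit ε x ∈ 𝒜 n := by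
  have := h.gradedMonoid
  rcases eq_or_ne n 0 with rfl | hn
  · change algebraMap R A (ε x) ∈ 𝒜 0
    rw [Algebra.algebraMap_eq_smul_one]
    exact (𝒜 0).smul_mem _ SetLike.GradedOne.one_mem
  · change algebraMap R A (ε x) ∈ 𝒜 n
    rw [h.counit_eq_zero n hn x hx, map_zero]
    exact zero_mem _

theorem conv_mem (h : IsGradedBialgebra 𝒜 Δ ε) {f g : A →ₗ[R] A}
    (hf : ∀ n, ∀ x ∈ 𝒜 n, f x ∈ 𝒜 n) (hg : ∀ n, ∀ x ∈ 𝒜 n, g x ∈ 𝒜 n) (n : ℕ) (x : A)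
    (hx : x ∈ 𝒜 n) : conv Δ f g x ∈ 𝒜 n :=
  have := h.gradedMonoid
  mul'_mem_of_mem_tensorDegree (map_mem_tensorDegree f g hf hg (h.comul_mem n x hx))

theorem convPow_mem (h : IsGradedBialgebra 𝒜 Δ ε) (k : ℕ) :
    ∀ n, ∀ x ∈ 𝒜 n, convPow Δ ε k x ∈ 𝒜 n := by
  induction k with
  | zero => exact convUnit_mem h
  | succ k ih =>
    exact conv_mem h ih fun n x hx => sub_mem (convUnit_mem h n x hx) hx

theorem antipodeSum_mem (h : IsGradedBialgebra 𝒜 Δ ε) (N n : ℕ) (x : A) (hx : x ∈ 𝒜 n) :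
    antipodeSum Δ ε N x ∈ 𝒜 n := by
  rw [antipodeSum, LinearMap.sum_apply]
  exact sum_mem fun k _ => convPow_mem h k n x hx

/-- In a connected bialgebra `η ∘ ε - id` vanishes in degree `0`, so its `k`-th convolution power
vanishes in all degrees below `k`. -/
theorem convPow_eq_zero (h : IsGradedBialgebra 𝒜 Δ ε) (h0 : 𝒜 0 = Submodule.span R {1})
    {k n : ℕ} (hk : n < k) {x : A} (hx : x ∈ 𝒜 n) : convPow Δ ε k x = 0 := by
  induction k generalizing n x with
  | zero => omega
  | succ k ih =>
    have := eq_of_mem_tensorDegree (f := LinearMap.mul' R A ∘ₗ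
      TensorProduct.map (convPow Δ ε k) (convUnit ε - LinearMap.id)) (g := 0)
      (fun i j hij a ha c hc => ?_) (h.comul_mem n x hx)
    · exact this
    · rcases lt_or_ge i k with hi | hi
      · simp [ih hi ha]
      · obtain rfl : j = 0 := by omega
        rw [h0] at hc
        obtain ⟨r, rfl⟩ := Submodule.mem_span_singleton.1 hc
        simp [convUnit]

theorem antipodeSum_stable (h : IsGradedBialgebra 𝒜 Δ ε) (h0 : 𝒜 0 = Submodule.span R {1})
    {N n : ℕ} (hN : n < N) {x : A} (hx : x ∈ 𝒜 n) :
    antipodeSum Δ ε N x = antipodeSum Δ ε (n + 1) x := by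
  simp only [antipodeSum, LinearMap.sum_apply]
  refine (Finset.sum_subset (Finset.range_subset_range.2 hN) fun k _ hk => ?_).symm
  exact convPow_eq_zero h h0 (by simpa using hk) hx

/-- In degree `n` the antipode is any partial sum of the geometric series with more than `n`
terms. -/
theorem exists_antipode_of_connected (h : IsGradedBialgebra 𝒜 Δ ε)
    (h0 : 𝒜 0 = Submodule.span R {1}) :
    ∃ S : A →ₗ[R] A, IsAntipode Δ ε S ∧ (∀ n, ∀ x ∈ 𝒜 n, S x ∈ 𝒜 n) ∧
      ∀ N n, n < N → ∀ x ∈ 𝒜 n, S x = antipodeSum Δ ε N x := by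
  obtain ⟨S, hS⟩ := exists_linearMap_of_isInternal h.isInternal
    fun n => antipodeSum Δ ε (n + 1)
  have hS' (N n : ℕ) (hN : n < N) (x : A) (hx : x ∈ 𝒜 n) : S x = antipodeSum Δ ε N x := by
    rw [hS n x hx, antipodeSum_stable h h0 hN hx]
  refine ⟨S, ⟨?_, ?_⟩, fun n x hx => ?_, hS'⟩
  · refine linearMap_ext_of_isInternal h.isInternal fun n x hx => ?_
    have h1 := eq_of_mem_tensorDegree (f := LinearMap.mul' R A ∘ₗ S.rTensor A)
      (g := LinearMap.mul' R A ∘ₗ (antipodeSum Δ ε (n + 1)).rTensor A)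
      (fun i j hij a ha c hc => by simp [hS' (n + 1) i (by omega) a ha]) (h.comul_mem n x hx)
    have h2 := LinearMap.congr_fun (conv_antipodeSum h.toIsBialgebra (n + 1)).1 x
    rw [LinearMap.sub_apply, convPow_eq_zero h h0 (Nat.lt_succ_self n) hx, sub_zero] at h2
    exact h1.trans h2
  · refine linearMap_ext_of_isInternal h.isInternal fun n x hx => ?_
    have h1 := eq_of_mem_tensorDegree (f := LinearMap.mul' R A ∘ₗ S.lTensor A)
      (g := LinearMap.mul' R A ∘ₗ (antipodeSum Δ ε (n + 1)).lTensor A)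
      (fun i j hij a ha c hc => by simp [hS' (n + 1) j (by omega) c hc]) (h.comul_mem n x hx)
    have h2 := LinearMap.congr_fun (conv_antipodeSum h.toIsBialgebra (n + 1)).2 x
    rw [LinearMap.sub_apply, convPow_eq_zero h h0 (Nat.lt_succ_self n) hx, sub_zero] at h2
    exact h1.trans h2
  · rw [hS' (n + 1) n (Nat.lt_succ_self n) x hx]
    exact antipodeSum_mem h _ n x hx

theorem IsGradedBialgebra.isGradedHopfAlgebra (h : IsGradedBialgebra 𝒜 Δ ε)
    (h0 : 𝒜 0 = Submodule.span R {1}) : IsGradedHopfAlgebra 𝒜 Δ ε where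
  toIsGradedBialgebra := h
  exists_antipode :=
    let ⟨S, hS, hdeg, _⟩ := exists_antipode_of_connected h h0
    ⟨S, hS, hdeg⟩

/-! ### Comodule morphisms and convolution -/

variable {ΔC : C →ₐ[R] C ⊗[R] C} {εC : C →ₐ[R] R} {ρ : A →ₐ[R] A ⊗[R] C}

/-- `f` is a morphism of comodules. -/
def IsComoduleMap (ρ : A →ₐ[R] A ⊗[R] C) (f : A →ₗ[R] A) : Prop :=
  ∀ x, ρ (f x) = f.rTensor C (ρ x)

theorem isComoduleMap_conv
    (hρ : (Algebra.TensorProduct.map Δ (.id R C)).comp ρ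
      = (mulRightLegs R A C).comp ((Algebra.TensorProduct.map ρ ρ).comp Δ))
    {f g : A →ₗ[R] A} (hf : IsComoduleMap ρ f) (hg : IsComoduleMap ρ g) :
    IsComoduleMap ρ (conv Δ f g) := by
  have h1 (z : A ⊗[R] A) : ρ (LinearMap.mul' R A (TensorProduct.map f g z)) =
      LinearMap.rTensor C (LinearMap.mul' R A ∘ₗ TensorProduct.map f g)
        (mulRightLegs R A C (Algebra.TensorProduct.map ρ ρ z)) := by
    induction z with
    | zero => simp
    | add x y hx hy => simp only [map_add, hx, hy]
    | tmul a b =>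
      simp only [TensorProduct.map_tmul, LinearMap.mul'_apply, map_mul, hf a, hg b,
        Algebra.TensorProduct.map_tmul]
      generalize ρ a = u
      generalize ρ b = v
      induction u with
      | zero => simp
      | add x y hx hy => simp only [map_add, add_mul, TensorProduct.add_tmul, hx, hy]
      | tmul a c =>
        induction v with
        | zero => simp
        | add x y hx hy => simp only [map_add, mul_add, TensorProduct.tmul_add, hx, hy]
        | tmul a' c' => simp [mulRightLegs]
  intro x
  have h2 : mulRightLegs R A C (Algebra.TensorProduct.map ρ ρ (Δ x)) =
      Algebra.TensorProduct.map Δ (.id R C) (ρ x) := (DFunLike.congr_fun hρ x).symm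
  have h3 (z : A ⊗[R] C) : Algebra.TensorProduct.map Δ (.id R C) z =
      Δ.toLinearMap.rTensor C z := rfl
  change ρ (LinearMap.mul' R A (TensorProduct.map f g (Δ x))) = _
  simp only [h1, h2, h3, conv, LinearMap.rTensor_comp_apply]

theorem isComoduleMap_sub {f g : A →ₗ[R] A} (hf : IsComoduleMap ρ f) (hg : IsComoduleMap ρ g) :
    IsComoduleMap ρ (f - g) := fun x => by
  rw [LinearMap.sub_apply, map_sub, hf, hg, LinearMap.rTensor_sub, LinearMap.sub_apply]

theorem isComoduleMap_sum {ι : Type*} (s : Finset ι) {f : ι → A →ₗ[R] A}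
    (hf : ∀ i, IsComoduleMap ρ (f i)) : IsComoduleMap ρ (∑ i ∈ s, f i) := fun x => by
  have : (∑ i ∈ s, f i).rTensor C = ∑ i ∈ s, (f i).rTensor C :=
    map_sum (LinearMap.rTensorHom C) f s
  simp only [this, LinearMap.sum_apply, map_sum, hf _ x]

theorem isComoduleMap_convUnit
    (hρ : ∀ x, Algebra.TensorProduct.map ε (.id R C) (ρ x) = ε x ⊗ₜ[R] (1 : C)) :
    IsComoduleMap ρ (convUnit ε) := fun x => by
  have h1 : ε.toLinearMap.rTensor C (ρ x) = ε x ⊗ₜ[R] (1 : C) := hρ x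
  rw [convUnit, LinearMap.rTensor_comp_apply, h1]
  change ρ (algebraMap R A (ε x)) = algebraMap R A (ε x) ⊗ₜ[R] (1 : C)
  rw [AlgHom.commutes]
  rfl

/-- A comodule bialgebra whose two bialgebras are connected is a comodule Hopf algebra: the
antipode is a sum of convolution powers of the comodule morphism `η ∘ ε - id`. -/
theorem IsRightGradedComoduleBialgebra.isRightGradedComoduleHopfAlgebra
    (h : IsRightGradedComoduleBialgebra 𝒜 𝒞 Δ ε ΔC εC ρ) (hA : 𝒜 0 = Submodule.span R {1})
    (hC : 𝒞 0 = Submodule.span R {1}) :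
    IsRightGradedComoduleHopfAlgebra 𝒜 𝒞 Δ ε ΔC εC ρ where
  toIsRightGradedComoduleBialgebra := h
  hopf_coacting := h.bialgebra_coacting.isGradedHopfAlgebra hC
  exists_antipode := by
    obtain ⟨S, hS, hdeg, hsum⟩ := exists_antipode_of_connected h.bialgebra hA
    have hunit := isComoduleMap_convUnit h.counit_comodule
    have hpow (k : ℕ) : IsComoduleMap ρ (convPow Δ ε k) := by
      induction k with
      | zero => exact hunit
      | succ k ih =>
        exact isComoduleMap_conv h.comul_comodule ih (isComoduleMap_sub hunit fun x => by simp)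
    refine ⟨S, hS, hdeg, linearMap_ext_of_isInternal h.bialgebra.isInternal fun n x hx => ?_⟩
    have h1 := eq_of_mem_tensorDegree (f := S.rTensor C)
      (g := (antipodeSum Δ ε (n + 1)).rTensor C)
      (fun i j hij a ha c hc => by simp [hsum (n + 1) i (by omega) a ha]) (h.coaction_mem n x hx)
    have h2 : ρ (antipodeSum Δ ε (n + 1) x) = (antipodeSum Δ ε (n + 1)).rTensor C (ρ x) :=
      isComoduleMap_sum _ hpow x
    change ρ (S x) = S.rTensor C (ρ x)
    rw [hsum (n + 1) n (Nat.lt_succ_self n) x hx, h1, h2]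

end Antipode

/-! ### Bialgebra identities checked on points -/

section Points

variable {k A C D G M N : Type*} [Field k] [CommRing A] [Algebra k A] [CommRing C] [Algebra k C]
  [CommRing D] [Algebra k D]

/-- The point `(f, g)` of `A ⊗ C`, for points `f` of `A` and `g` of `C`. -/
noncomputable def pairEval (f : A →ₐ[k] k) (g : C →ₐ[k] k) : A ⊗[k] C →ₐ[k] k :=
  (Algebra.TensorProduct.lmul' k).comp (Algebra.TensorProduct.map f g)

@[simp]
theorem pairEval_tmul (f : A →ₐ[k] k) (g : C →ₐ[k] k) (a : A) (c : C) :
    pairEval f g (a ⊗ₜ c) = f a * g c := by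
  simp [pairEval]

theorem pairEval_map {A' C' : Type*} [CommRing A'] [Algebra k A'] [CommRing C'] [Algebra k C']
    (f : A' →ₐ[k] k) (g : C' →ₐ[k] k) (u : A →ₐ[k] A') (v : C →ₐ[k] C') :
    (pairEval f g).comp (Algebra.TensorProduct.map u v) = pairEval (f.comp u) (g.comp v) :=
  Algebra.TensorProduct.ext' fun a c => by simp

theorem pairEval_assoc (f : A →ₐ[k] k) (g : C →ₐ[k] k) (h : D →ₐ[k] k) :
    (pairEval f (pairEval g h)).comp (Algebra.TensorProduct.assoc k k k A C D).toAlgHom =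
      pairEval (pairEval f g) h := by
  refine Algebra.TensorProduct.ext (Algebra.TensorProduct.ext' fun a c => ?_)
    (AlgHom.ext fun d => ?_)
  · simp
  · simp [Algebra.TensorProduct.one_def]

/-- A family of points of `A` that separates the elements of `A`. -/
def Separates (ev : G → A →ₐ[k] k) : Prop := ∀ x, (∀ c, ev c x = 0) → x = 0

theorem Separates.algHom_ext {ev : G → A →ₐ[k] k} (h : Separates ev) {f g : D →ₐ[k] A}
    (hfg : ∀ c, (ev c).comp f = (ev c).comp g) : f = g :=
  AlgHom.ext fun x => sub_eq_zero.1 <| h _ fun c => by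
    rw [map_sub, sub_eq_zero]
    exact AlgHom.congr_fun (hfg c) x

/-- If points separate the elements of `A` and of `C`, then pairs of points separate the elements
of `A ⊗ C`: expand in a basis of `C`. -/
theorem Separates.pairEval {evA : G → A →ₐ[k] k} {evC : M → C →ₐ[k] k} (hA : Separates evA)
    (hC : Separates evC) :
    Separates fun p : G × M => pairEval (evA p.1) (evC p.2) := by
  intro z hz
  classical
  let b := Module.Free.chooseBasis k C
  let e := TensorProduct.equivFinsuppOfBasisRight (M := A) b
  have h1 (c : G) (i) (z : A ⊗[k] C) : b.repr (Algebra.TensorProduct.lid k C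
      (Algebra.TensorProduct.map (evA c) (.id k C) z)) i = evA c (e z i) := by
    induction z with
    | zero => simp
    | add x y hx hy => simp only [map_add, Finsupp.add_apply, hx, hy]
    | tmul a c' => simp [e, mul_comm]
  have h2 (c : G) (d : M) (z : A ⊗[k] C) : evC d (Algebra.TensorProduct.lid k C
      (Algebra.TensorProduct.map (evA c) (.id k C) z)) =
      MultFeedback.pairEval (evA c) (evC d) z := by
    induction z with
    | zero => simp
    | add x y hx hy => simp only [map_add, hx, hy]
    | tmul a c' => simp
  have h3 (c : G) := hC _ fun d => (h2 c d z).trans (hz (c, d))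
  have h4 : e z = 0 := by
    ext i
    refine hA _ fun c => ?_
    rw [← h1, h3, map_zero, Finsupp.zero_apply]
  exact e.map_eq_zero_iff.1 h4

/-- The algebra map `f : A → D ⊗ C` is dual to the operation `op` on points. -/
def DualOnPoints (evA : G → A →ₐ[k] k) (evD : N → D →ₐ[k] k) (evC : M → C →ₐ[k] k)
    (f : A →ₐ[k] D ⊗[k] C) (op : N → M → G) : Prop :=
  ∀ c d, (pairEval (evD c) (evC d)).comp f = evA (op c d)

variable {evA : G → A →ₐ[k] k} {evC : M → C →ₐ[k] k}

/-- An algebra map dual to a multiplication on points makes `A` a bialgebra if the multiplication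
is associative and unital. -/
theorem isBialgebra_of_points (hsep : Separates evA) {Δ : A →ₐ[k] A ⊗[k] A} {op : G → G → G}
    {e : G} (hΔ : DualOnPoints evA evA evA Δ op)
    (hassoc : ∀ a b c, op (op a b) c = op a (op b c)) (hleft : ∀ a, op e a = a)
    (hright : ∀ a, op a e = a) : IsBialgebra Δ (evA e) where
  coassoc := (hsep.pairEval (hsep.pairEval hsep)).algHom_ext fun ⟨a, b, c⟩ => by
    dsimp only
    rw [← AlgHom.comp_assoc, pairEval_assoc, ← AlgHom.comp_assoc, pairEval_map, hΔ,
      AlgHom.comp_id, hΔ, ← AlgHom.comp_assoc, pairEval_map, hΔ, AlgHom.comp_id, hΔ, hassoc]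
  counit_left := by
    rw [← AlgHom.cancel_left (f := (Algebra.TensorProduct.lid k A).toAlgHom)
      (Algebra.TensorProduct.lid k A).injective]
    refine hsep.algHom_ext fun a => ?_
    have : (evA a).comp ((Algebra.TensorProduct.lid k A).toAlgHom.comp
        (Algebra.TensorProduct.map (evA e) (.id k A))) = pairEval (evA e) (evA a) :=
      Algebra.TensorProduct.ext' fun a c => by simp
    rw [← AlgHom.comp_assoc _ _ Δ, ← AlgHom.comp_assoc, this, hΔ, hleft]
    ext x; simp
  counit_right := by
    rw [← AlgHom.cancel_left (f := (Algebra.TensorProduct.rid k k A).toAlgHom)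
      (Algebra.TensorProduct.rid k k A).injective]
    refine hsep.algHom_ext fun a => ?_
    have : (evA a).comp ((Algebra.TensorProduct.rid k k A).toAlgHom.comp
        (Algebra.TensorProduct.map (.id k A) (evA e))) = pairEval (evA a) (evA e) :=
      Algebra.TensorProduct.ext' fun a c => by simp [mul_comm]
    rw [← AlgHom.comp_assoc _ _ Δ, ← AlgHom.comp_assoc, this, hΔ, hright]
    ext x; simp

theorem isRightCoaction_of_points (hA : Separates evA) (hC : Separates evC)
    {Δ : C →ₐ[k] C ⊗[k] C} {ρ : A →ₐ[k] A ⊗[k] C} {op : M → M → M} {act : G → M → G} {e : M}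
    (hΔ : DualOnPoints evC evC evC Δ op) (hρ : DualOnPoints evA evA evC ρ act)
    (hassoc : ∀ a b c, act (act a b) c = act a (op b c)) (hunit : ∀ a, act a e = a) :
    IsRightCoaction Δ (evC e) ρ where
  coassoc := (hA.pairEval (hC.pairEval hC)).algHom_ext fun ⟨a, b, c⟩ => by
    dsimp only
    rw [← AlgHom.comp_assoc, pairEval_assoc, ← AlgHom.comp_assoc, pairEval_map, hρ,
      AlgHom.comp_id, hρ, ← AlgHom.comp_assoc, pairEval_map, hΔ, AlgHom.comp_id, hρ, hassoc]
  counit := by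
    rw [← AlgHom.cancel_left (f := (Algebra.TensorProduct.rid k k A).toAlgHom)
      (Algebra.TensorProduct.rid k k A).injective]
    refine hA.algHom_ext fun a => ?_
    have : (evA a).comp ((Algebra.TensorProduct.rid k k A).toAlgHom.comp
        (Algebra.TensorProduct.map (.id k A) (evC e))) = pairEval (evA a) (evC e) :=
      Algebra.TensorProduct.ext' fun a c => by simp [mul_comm]
    rw [← AlgHom.comp_assoc _ _ ρ, ← AlgHom.comp_assoc, this, hρ, hunit]
    ext x; simp

/-- The comultiplication `δ` is a comodule morphism if the action on points distributes over the
operation dual to `δ`. -/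
theorem comul_comodule_of_points (hA : Separates evA) (hC : Separates evC)
    {δ : A →ₐ[k] A ⊗[k] A} {ρ : A →ₐ[k] A ⊗[k] C} {op : G → G → G} {act : G → M → G}
    (hδ : DualOnPoints evA evA evA δ op) (hρ : DualOnPoints evA evA evC ρ act)
    (hdistrib : ∀ a b c, act (op a b) c = op (act a c) (act b c)) :
    (Algebra.TensorProduct.map δ (.id k C)).comp ρ
      = (mulRightLegs k A C).comp ((Algebra.TensorProduct.map ρ ρ).comp δ) := by
  refine ((hA.pairEval hA).pairEval hC).algHom_ext fun ⟨⟨a, b⟩, c⟩ => ?_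
  dsimp only
  have h : (pairEval (pairEval (evA a) (evA b)) (evC c)).comp (mulRightLegs k A C) =
      pairEval (pairEval (evA a) (evC c)) (pairEval (evA b) (evC c)) := by
    refine Algebra.TensorProduct.ext (Algebra.TensorProduct.ext' fun a c => ?_)
      (Algebra.TensorProduct.ext' fun a c => ?_)
    · simp [mulRightLegs, Algebra.TensorProduct.one_def]
    · simp [mulRightLegs, Algebra.TensorProduct.one_def]
  rw [← AlgHom.comp_assoc, pairEval_map, hδ, AlgHom.comp_id, hρ, hdistrib, ← AlgHom.comp_assoc, h,
    ← AlgHom.comp_assoc, pairEval_map, hρ, hρ, hδ]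

/-- The counit is a comodule morphism if it is a fixed point of the action. -/
theorem counit_comodule_of_points (hC : Separates evC) {ρ : A →ₐ[k] A ⊗[k] C}
    {act : G → M → G} {e : G} (hρ : DualOnPoints evA evA evC ρ act) (hfix : ∀ c, act e c = e)
    (x : A) :
    Algebra.TensorProduct.map (evA e) (.id k C) (ρ x) = evA e x ⊗ₜ[k] (1 : C) := by
  apply (Algebra.TensorProduct.lid k C).injective
  refine sub_eq_zero.1 (hC _ fun c => ?_)
  have h : (evC c).comp ((Algebra.TensorProduct.lid k C).toAlgHom.comp
      (Algebra.TensorProduct.map (evA e) (.id k C))) = pairEval (evA e) (evC c) :=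
    Algebra.TensorProduct.ext' fun a c => by simp
  have h1 := AlgHom.congr_fun h (ρ x)
  have h2 := AlgHom.congr_fun (hρ e c) x
  rw [hfix] at h2
  rw [map_sub, sub_eq_zero]
  refine (h1.trans h2).trans ?_
  simp

end Points

/-! ### Algebra maps on a weighted polynomial algebra -/

section Weighted

variable {R σ D : Type*} [CommRing R] [CommRing D] [Algebra R D]

/-- An algebra map out of a polynomial algebra respects gradings if it does so on variables. -/
theorem algHom_mem_of_isWeightedHomogeneous {w : σ → ℕ} (𝒟 : ℕ → Submodule R D)
    [SetLike.GradedMonoid 𝒟] (F : MvPolynomial σ R →ₐ[R] D)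
    (hF : ∀ s, F (MvPolynomial.X s) ∈ 𝒟 (w s)) {n : ℕ} {p : MvPolynomial σ R}
    (hp : p ∈ MvPolynomial.weightedHomogeneousSubmodule R w n) : F p ∈ 𝒟 n := by
  rw [MvPolynomial.mem_weightedHomogeneousSubmodule] at hp
  induction hp using MvPolynomial.IsWeightedHomogeneous.induction_on with
  | zero => rw [map_zero]; exact zero_mem _
  | add p q _ _ hp hq => rw [map_add]; exact add_mem hp hq
  | monomial d r hd =>
    rw [MvPolynomial.monomial_eq, ← MvPolynomial.smul_eq_C_mul, map_smul, Finsupp.prod, map_prod]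
    simp only [map_pow]
    refine (𝒟 n).smul_mem r ?_
    rw [← hd, Finsupp.weight_apply]
    exact SetLike.prod_pow_mem_graded 𝒟 _ _ _ fun s _ => hF s

theorem tensorDegree_gradedMonoid {A C : Type*} [CommRing A] [Algebra R A] [CommRing C]
    [Algebra R C] (𝒜 : ℕ → Submodule R A) (𝒞 : ℕ → Submodule R C) [SetLike.GradedMonoid 𝒜]
    [SetLike.GradedMonoid 𝒞] : SetLike.GradedMonoid (tensorDegree 𝒜 𝒞) where
  one_mem := one_mem_tensorDegree
  mul_mem _ _ _ _ := mul_mem_tensorDegree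

/-- The image of a graded module under a surjection with a graded section is graded. -/
theorem isInternal_map_of_section {M N : Type*} [AddCommGroup M] [Module R M] [AddCommGroup N]
    [Module R N] {ℳ : ℕ → Submodule R M} (h : DirectSum.IsInternal ℳ) (p : M →ₗ[R] N)
    (s : N →ₗ[R] M) (hps : ∀ y, p (s y) = y) (hs : ∀ n, ∀ x ∈ ℳ n, s (p x) ∈ ℳ n) :
    DirectSum.IsInternal fun n => (ℳ n).map p := by
  have hle (n : ℕ) : ((ℳ n).map p).map s ≤ ℳ n := by
    rintro _ ⟨_, ⟨x, hx, rfl⟩, rfl⟩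
    exact hs n x hx
  refine DirectSum.isInternal_submodule_of_iSupIndep_of_iSup_eq_top ?_ ?_
  · intro n
    rw [Submodule.disjoint_def]
    intro y hy hy'
    have h1 : s y ∈ ℳ n := hle n (Submodule.mem_map_of_mem hy)
    have h2 : s y ∈ ⨆ j, ⨆ _ : j ≠ n, ℳ j := by
      have := Submodule.mem_map_of_mem (f := s) hy'
      simp only [Submodule.map_iSup] at this
      exact iSup₂_mono (fun j _ => hle j) this
    have h3 := (Submodule.disjoint_def.1 (h.submodule_iSupIndep n)) _ h1 h2
    rw [← hps y, h3, map_zero]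
  · rw [← Submodule.map_iSup, h.submodule_iSup_eq_top, Submodule.map_top, LinearMap.range_eq_top]
    exact fun y => ⟨s y, hps y⟩

end Weighted

/-! ### The algebra maps on `𝓑` -/

section AlgebraB

variable {m : ℕ}

theorem evalAt_coord (c : VSeries m) (j : Fin m) (η : Word m) : evalAt c (coord j η) = c j η := by
  simp [evalAt, coord]

theorem separates_evalAt : Separates (evalAt (m := m)) := fun x hx =>
  MvPolynomial.funext fun v => by
    have := hx fun j η => v (j, η)
    rw [map_zero, ← this]
    rfl

theorem counitB_eq : counitB m = evalAt (vone m) := rfl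

theorem dualOnPoints_of_isDualTo {f : B m →ₐ[ℝ] B m ⊗[ℝ] B m}
    {op : VSeries m → VSeries m → VSeries m} (h : IsDualTo f op) :
    DualOnPoints evalAt evalAt evalAt f op := fun c d =>
  MvPolynomial.algHom_ext fun p => (h p.1 p.2 c d).trans (evalAt_coord _ _ _).symm

theorem isDualTo_iff {F : B m →ₐ[ℝ] B m ⊗[ℝ] B m} {op : VSeries m → VSeries m → VSeries m}
    (hF : IsDualTo F op) (f : B m →ₐ[ℝ] B m ⊗[ℝ] B m) : IsDualTo f op ↔ f = F := by
  refine ⟨fun h => ?_, fun h => h ▸ hF⟩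
  refine (separates_evalAt.pairEval separates_evalAt).algHom_ext fun p => ?_
  rw [dualOnPoints_of_isDualTo h, dualOnPoints_of_isDualTo hF]

/-- The coproduct of `𝓑` dual to the shuffle product. -/
noncomputable def comulShuffle (m : ℕ) : B m →ₐ[ℝ] B m ⊗[ℝ] B m :=
  MvPolynomial.aeval fun p =>
    ((unshuffle p.2).map fun q => coord p.1 q.1 ⊗ₜ[ℝ] coord p.1 q.2).sum

/-- The polynomial in the coordinates of `d` that gives the coefficient of `η ↶ d` at `ξ`; the
arguments are `η` and `ξ`, and the recursion is that of `wordMix`. -/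
noncomputable def wordMixPoly : Word m → Word m → B m
  | [] => fun ξ => if ξ = [] then 1 else 0
  | x :: η => fun ξ => match ξ with
    | [] => 0
    | y :: w => if y = x then
        Fin.cases (motive := fun _ => B m) (wordMixPoly η w)
          (fun i => ((unshuffle w).map fun q => coord i q.1 * wordMixPoly η q.2).sum) x
      else 0

/-- The words of length at most `n`. -/
noncomputable def wordsUpTo (m n : ℕ) : Finset (Word m) :=
  (List.finite_length_le (Fin (m + 1)) n).toFinset

/-- The coaction of `𝓑` dual to `↶`. -/
noncomputable def coactionMix (m : ℕ) : B m →ₐ[ℝ] B m ⊗[ℝ] B m :=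
  MvPolynomial.aeval fun p =>
    ∑ η ∈ wordsUpTo m p.2.length, coord p.1 η ⊗ₜ[ℝ] wordMixPoly η p.2

/-- The coproduct of `𝓑` dual to `⋆`. -/
noncomputable def comulStar (m : ℕ) : B m →ₐ[ℝ] B m ⊗[ℝ] B m :=
  MvPolynomial.aeval fun p =>
    ((unshuffle p.2).map fun q =>
      (1 : B m) ⊗ₜ[ℝ] coord p.1 q.1 * coactionMix m (coord p.1 q.2)).sum

theorem comulShuffle_coord (j : Fin m) (η : Word m) : comulShuffle m (coord j η) =
    ((unshuffle η).map fun q => coord j q.1 ⊗ₜ[ℝ] coord j q.2).sum := by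
  simp [comulShuffle, coord]

theorem coactionMix_coord (j : Fin m) (ξ : Word m) : coactionMix m (coord j ξ) =
    ∑ η ∈ wordsUpTo m ξ.length, coord j η ⊗ₜ[ℝ] wordMixPoly η ξ := by
  simp [coactionMix, coord]

theorem comulStar_coord (j : Fin m) (η : Word m) : comulStar m (coord j η) =
    ((unshuffle η).map fun q =>
      (1 : B m) ⊗ₜ[ℝ] coord j q.1 * coactionMix m (coord j q.2)).sum := by
  simp [comulStar, coord]

theorem evalAt_wordMixPoly (d : VSeries m) (η ξ : Word m) :
    evalAt d (wordMixPoly η ξ) = wordMix d η ξ := by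
  induction η generalizing ξ with
  | nil =>
    simp only [wordMixPoly, wordMix]
    split_ifs <;> simp
  | cons x η ih =>
    cases ξ with
    | nil => simp [wordMixPoly, wordMix, consSeries]
    | cons y w =>
      simp only [wordMixPoly, wordMix, consSeries]
      split_ifs with h
      · induction x using Fin.cases with
        | zero => exact ih w
        | succ i => simp [shuffle, map_list_sum, Function.comp_def, evalAt_coord, ih]
      · exact map_zero _

theorem evalAt₂_tmul (c d : VSeries m) (a b : B m) :
    evalAt₂ c d (a ⊗ₜ[ℝ] b) = evalAt c a * evalAt d b :=
  pairEval_tmul (evalAt c) (evalAt d) a b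

theorem isDualTo_comulShuffle : IsDualTo (comulShuffle m) vshuffle := fun j η c d => by
  simp [comulShuffle_coord, map_list_sum, Function.comp_def, evalAt₂_tmul, evalAt_coord, vshuffle,
    shuffle]

theorem isDualTo_coactionMix : IsDualTo (coactionMix m) vmix := fun j ξ c d => by
  simp only [coactionMix_coord, map_sum, evalAt₂_tmul, evalAt_coord, evalAt_wordMixPoly, vmix, mix]
  refine (finsum_eq_sum_of_support_subset _ fun η hη => ?_).symm
  rw [wordsUpTo, Set.Finite.coe_toFinset]
  by_contra hlt
  exact hη (by simp [wordMix_eq_zero d η ξ (by simpa using hlt)])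

theorem isDualTo_comulStar : IsDualTo (comulStar m) star := fun j η c d => by
  have h (ξ : Word m) := isDualTo_coactionMix j ξ c d
  simp [comulStar_coord, map_list_sum, Function.comp_def, evalAt₂_tmul, evalAt_coord, h, star,
    vshuffle, shuffle]

/-! ### The grading of `𝓑` -/

theorem gradedMonoid_gradeB : SetLike.GradedMonoid (gradeB m) :=
  MvPolynomial.WeightedHomogeneousSubmodule.gradedMonoid

theorem isAlgebraGrading_gradeB : IsAlgebraGrading (gradeB m) where
  isInternal := by
    let _ := MvPolynomial.weightedDecomposition ℝ fun p : Fin m × Word m => p.2.length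
    exact DirectSum.Decomposition.isInternal
      (MvPolynomial.weightedHomogeneousSubmodule ℝ fun p : Fin m × Word m => p.2.length)
  gradedMonoid := gradedMonoid_gradeB

theorem coord_mem (j : Fin m) (η : Word m) : coord j η ∈ gradeB m η.length :=
  MvPolynomial.isWeightedHomogeneous_X ℝ _ (j, η)

/-- The coefficient of `η ↶ d` at `ξ` has degree `|ξ| - |η|` in `d`. -/
theorem wordMixPoly_mem (η ξ : Word m) (n : ℕ) (h : η.length + n = ξ.length) :
    wordMixPoly η ξ ∈ gradeB m n := by
  have := gradedMonoid_gradeB (m := m)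
  induction η generalizing ξ n with
  | nil =>
    simp only [wordMixPoly]
    split_ifs with hξ
    · obtain rfl : n = 0 := by simpa [hξ] using h
      exact SetLike.GradedOne.one_mem
    · exact zero_mem _
  | cons x η ih =>
    cases ξ with
    | nil => simp at h
    | cons y w =>
      have hw : η.length + n = w.length := by simp at h; omega
      simp only [wordMixPoly]
      split_ifs
      · induction x using Fin.cases with
        | zero => exact ih w n hw
        | succ i =>
          refine list_sum_mem ?_
          simp only [List.mem_map, forall_exists_index, and_imp]
          rintro _ q hq rfl
          have hq' := length_of_mem_unshuffle w q hq
          rcases le_or_gt η.length q.2.length with hle | hlt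
          · have hn : q.1.length + (q.2.length - η.length) = n := by omega
            rw [← hn]
            exact SetLike.GradedMul.mul_mem (coord_mem i q.1) (ih q.2 _ (by omega))
          · have h0 : wordMixPoly η q.2 = 0 := separates_evalAt _ fun d => by
              rw [evalAt_wordMixPoly, wordMix_eq_zero d η q.2 hlt]
            rw [h0, mul_zero]
            exact zero_mem _
      · exact zero_mem _

theorem comulShuffle_mem (n : ℕ) (x : B m) (hx : x ∈ gradeB m n) :
    comulShuffle m x ∈ tensorDegree (gradeB m) (gradeB m) n := by
  have := gradedMonoid_gradeB (m := m)
  have := tensorDegree_gradedMonoid (gradeB m) (gradeB m)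
  refine algHom_mem_of_isWeightedHomogeneous _ (comulShuffle m) (fun ⟨j, η⟩ => ?_) hx
  change comulShuffle m (coord j η) ∈ _
  rw [comulShuffle_coord]
  refine list_sum_mem ?_
  simp only [List.mem_map, forall_exists_index, and_imp]
  rintro _ q hq rfl
  exact tmul_mem_tensorDegree (length_of_mem_unshuffle η q hq) (coord_mem j _) (coord_mem j _)

theorem coactionMix_coord_mem (j : Fin m) (ξ : Word m) :
    coactionMix m (coord j ξ) ∈ tensorDegree (gradeB m) (gradeB m) ξ.length := by
  rw [coactionMix_coord]
  refine sum_mem fun η hη => ?_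
  have hle : η.length ≤ ξ.length := by simpa [wordsUpTo] using hη
  exact tmul_mem_tensorDegree (Nat.add_sub_cancel' hle) (coord_mem j η)
    (wordMixPoly_mem η ξ _ (Nat.add_sub_cancel' hle))

theorem coactionMix_mem (n : ℕ) (x : B m) (hx : x ∈ gradeB m n) :
    coactionMix m x ∈ tensorDegree (gradeB m) (gradeB m) n := by
  have := gradedMonoid_gradeB (m := m)
  have := tensorDegree_gradedMonoid (gradeB m) (gradeB m)
  exact algHom_mem_of_isWeightedHomogeneous _ (coactionMix m)
    (fun ⟨j, ξ⟩ => coactionMix_coord_mem j ξ) hx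

theorem comulStar_mem (n : ℕ) (x : B m) (hx : x ∈ gradeB m n) :
    comulStar m x ∈ tensorDegree (gradeB m) (gradeB m) n := by
  have := gradedMonoid_gradeB (m := m)
  have := tensorDegree_gradedMonoid (gradeB m) (gradeB m)
  refine algHom_mem_of_isWeightedHomogeneous _ (comulStar m) (fun ⟨j, η⟩ => ?_) hx
  change comulStar m (coord j η) ∈ tensorDegree (gradeB m) (gradeB m) η.length
  rw [comulStar_coord]
  refine list_sum_mem ?_
  simp only [List.mem_map, forall_exists_index, and_imp]
  rintro _ q hq rfl
  rw [← length_of_mem_unshuffle η q hq]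
  exact mul_mem_tensorDegree (tmul_mem_tensorDegree (zero_add _) SetLike.GradedOne.one_mem
    (coord_mem j _)) (coactionMix_coord_mem j _)

/-- The submodule of `ℝ` that is everything in degree `0` and zero in the other degrees. -/
def gradeReal (n : ℕ) : Submodule ℝ ℝ := if n = 0 then ⊤ else ⊥

theorem counitB_eq_zero (n : ℕ) (hn : n ≠ 0) (x : B m) (hx : x ∈ gradeB m n) :
    counitB m x = 0 := by
  have : SetLike.GradedMonoid gradeReal :=
    { one_mem := by simp [gradeReal]
      mul_mem := fun i j a b ha hb => by
        by_cases hi : i = 0 <;> by_cases hj : j = 0 <;> simp_all [gradeReal] }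
  have h := algHom_mem_of_isWeightedHomogeneous gradeReal (counitB m) (fun ⟨j, η⟩ => ?_) hx
  · simpa [gradeReal, hn] using h
  · by_cases hη : η = [] <;> simp [counitB, gradeReal, hη]

theorem isRightGradedComoduleBialgebra_B :
    IsRightGradedComoduleBialgebra (gradeB m) (gradeB m) (comulShuffle m) (counitB m)
      (comulStar m) (counitB m) (coactionMix m) :=
  have hδ := dualOnPoints_of_isDualTo (isDualTo_comulShuffle (m := m))
  have hΔ := dualOnPoints_of_isDualTo (isDualTo_comulStar (m := m))
  have hρ := dualOnPoints_of_isDualTo (isDualTo_coactionMix (m := m))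
  { bialgebra :=
      { toIsAlgebraGrading := isAlgebraGrading_gradeB
        toIsBialgebra := by
          rw [counitB_eq]
          exact isBialgebra_of_points separates_evalAt hδ vshuffle_assoc vone_vshuffle vshuffle_vone
        comul_mem := comulShuffle_mem
        counit_eq_zero := counitB_eq_zero }
    bialgebra_coacting :=
      { toIsAlgebraGrading := isAlgebraGrading_gradeB
        toIsBialgebra := by
          rw [counitB_eq]
          exact isBialgebra_of_points separates_evalAt hΔ star_assoc vone_star star_vone
        comul_mem := comulStar_mem
        counit_eq_zero := counitB_eq_zero }
    coaction := by
      rw [counitB_eq]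
      exact isRightCoaction_of_points separates_evalAt separates_evalAt hΔ hρ vmix_vmix vmix_vone
    coaction_mem := coactionMix_mem
    comul_comodule := comul_comodule_of_points separates_evalAt separates_evalAt hδ hρ
      vshuffle_vmix
    counit_comodule := by
      rw [counitB_eq]
      exact counit_comodule_of_points separates_evalAt hρ vone_vmix }

end AlgebraB

/-! ### The quotient `𝓗` -/

section AlgebraH

variable {m : ℕ}

theorem proj_coord_nil (j : Fin m) : proj m (coord j []) = 1 := by
  rw [← sub_eq_zero, ← map_one (proj m), ← map_sub]
  exact Ideal.Quotient.eq_zero_iff_mem.2 (Ideal.subset_span ⟨j, rfl⟩)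

theorem eq_zero_of_mem_idealI {D : Type*} [Semiring D] [Algebra ℝ D] {f : B m →ₐ[ℝ] D}
    (hf : ∀ j, f (coord j []) = 1) (x : B m) (hx : x ∈ idealI m) : f x = 0 := by
  have : idealI m ≤ RingHom.ker f := by
    rw [idealI, Ideal.span_le]
    rintro _ ⟨j, rfl⟩
    change f (coord j [] - 1) = 0
    rw [sub_eq_add_neg, map_add, hf, ← map_one f, ← map_add, add_neg_cancel, map_zero]
  exact this hx

/-- The map induced on `𝓗` by an algebra map on `𝓑` with `a^j_1 ↦ 1`. -/
noncomputable def liftH {D : Type*} [Semiring D] [Algebra ℝ D] (f : B m →ₐ[ℝ] D)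
    (hf : ∀ j, f (coord j []) = 1) : H m →ₐ[ℝ] D :=
  Ideal.Quotient.liftₐ (idealI m) f (eq_zero_of_mem_idealI hf)

theorem liftH_comp_proj {D : Type*} [Semiring D] [Algebra ℝ D] (f : B m →ₐ[ℝ] D)
    (hf : ∀ j, f (coord j []) = 1) : (liftH f hf).comp (proj m) = f :=
  Ideal.Quotient.liftₐ_comp _ _ _

theorem comp_proj_eq_iff {D : Type*} [Semiring D] [Algebra ℝ D] (f : B m →ₐ[ℝ] D)
    (hf : ∀ j, f (coord j []) = 1) (g : H m →ₐ[ℝ] D) : g.comp (proj m) = f ↔ g = liftH f hf := by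
  refine ⟨fun h => Ideal.Quotient.algHom_ext ℝ ?_, fun h => h ▸ liftH_comp_proj f hf⟩
  exact h.trans (liftH_comp_proj f hf).symm

theorem algHom_ext_of_comp_proj {D : Type*} [Semiring D] [Algebra ℝ D] {f g : H m →ₐ[ℝ] D}
    (h : f.comp (proj m) = g.comp (proj m)) : f = g := Ideal.Quotient.algHom_ext ℝ h

/-- The substitution `a^j_1 ↦ 1` in `𝓑`. -/
noncomputable def substOne (m : ℕ) : B m →ₐ[ℝ] B m :=
  MvPolynomial.aeval fun p => if p.2 = [] then 1 else coord p.1 p.2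

theorem substOne_coord (j : Fin m) (η : Word m) :
    substOne m (coord j η) = if η = [] then 1 else coord j η := by
  simp [substOne, coord]

theorem substOne_coord_nil (j : Fin m) : substOne m (coord j []) = 1 := by
  rw [substOne_coord, if_pos rfl]

/-- The section of `𝓑 → 𝓗` whose image is the subalgebra generated by the coordinates at nonempty
words. -/
noncomputable def sectionH (m : ℕ) : H m →ₐ[ℝ] B m :=
  liftH (substOne m) substOne_coord_nil

theorem sectionH_proj (x : B m) : sectionH m (proj m x) = substOne m x :=
  AlgHom.congr_fun (liftH_comp_proj (substOne m) substOne_coord_nil) x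

theorem proj_sectionH (y : H m) : proj m (sectionH m y) = y := by
  have : (proj m).comp (sectionH m) = .id ℝ (H m) := by
    refine algHom_ext_of_comp_proj (MvPolynomial.algHom_ext fun ⟨j, η⟩ => ?_)
    change proj m (sectionH m (proj m (coord j η))) = proj m (coord j η)
    rw [sectionH_proj, substOne_coord]
    split_ifs with h
    · rw [h, proj_coord_nil, map_one]
    · rfl
  exact AlgHom.congr_fun this y

/-- The tuples of series with constant coefficients `1`: the points of `𝓗`. -/
abbrev UnitSeries (m : ℕ) := {c : VSeries m // ∀ j, c j [] = 1}

/-- The value of an element of `𝓗` at a tuple of series with constant coefficients `1`. -/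
noncomputable def evalH (c : UnitSeries m) : H m →ₐ[ℝ] ℝ :=
  liftH (evalAt c.1) fun j => by rw [evalAt_coord, c.2]

theorem evalH_comp_proj (c : UnitSeries m) : (evalH c).comp (proj m) = evalAt c.1 :=
  liftH_comp_proj _ _

theorem separates_evalH : Separates (evalH (m := m)) := fun y hy => by
  have h : sectionH m y = 0 := separates_evalAt _ fun c => by
    -- the value of `sectionH y` at `c` does not see the constant coefficients of `c`
    let c' : UnitSeries m := ⟨fun j η => if η = [] then 1 else c j η, fun j => if_pos rfl⟩
    have : (evalAt c).comp (sectionH m) = evalH c' := by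
      refine algHom_ext_of_comp_proj (MvPolynomial.algHom_ext fun ⟨j, η⟩ => ?_)
      rw [evalH_comp_proj]
      change evalAt c (sectionH m (proj m (coord j η))) = evalAt c'.1 (coord j η)
      rw [sectionH_proj, substOne_coord, evalAt_coord]
      change _ = if η = [] then 1 else c j η
      split_ifs
      · exact map_one _
      · exact evalAt_coord c j η
    exact (AlgHom.congr_fun this y).trans (hy c')
  rw [← proj_sectionH y, h, map_zero]

/-- The map `𝓗 → 𝓗 ⊗ 𝓗` induced by `f : 𝓑 → 𝓑 ⊗ 𝓑`. -/
noncomputable def inducedH (f : B m →ₐ[ℝ] B m ⊗[ℝ] B m)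
    (hf : ∀ j, (Algebra.TensorProduct.map (proj m) (proj m)).comp f (coord j []) = 1) :
    H m →ₐ[ℝ] H m ⊗[ℝ] H m :=
  liftH ((Algebra.TensorProduct.map (proj m) (proj m)).comp f) hf

theorem isInducedBy_iff (f : B m →ₐ[ℝ] B m ⊗[ℝ] B m)
    (hf : ∀ j, (Algebra.TensorProduct.map (proj m) (proj m)).comp f (coord j []) = 1)
    (g : H m →ₐ[ℝ] H m ⊗[ℝ] H m) : IsInducedBy g f ↔ g = inducedH f hf :=
  comp_proj_eq_iff _ hf g

theorem inducedH_proj (f : B m →ₐ[ℝ] B m ⊗[ℝ] B m)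
    (hf : ∀ j, (Algebra.TensorProduct.map (proj m) (proj m)).comp f (coord j []) = 1) (x : B m) :
    inducedH f hf (proj m x) = Algebra.TensorProduct.map (proj m) (proj m) (f x) :=
  AlgHom.congr_fun
    (liftH_comp_proj ((Algebra.TensorProduct.map (proj m) (proj m)).comp f) hf) x

/-- If `f` is dual to `op` and `op` preserves the condition that the constant coefficients are
`1`, then the map induced by `f` is dual to the restriction of `op`. -/
theorem dualOnPoints_inducedH {f : B m →ₐ[ℝ] B m ⊗[ℝ] B m}
    {op : VSeries m → VSeries m → VSeries m} (h : IsDualTo f op)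
    (hf : ∀ j, (Algebra.TensorProduct.map (proj m) (proj m)).comp f (coord j []) = 1)
    {opH : UnitSeries m → UnitSeries m → UnitSeries m}
    (hop : ∀ c d, (opH c d).1 = op c.1 d.1) :
    DualOnPoints evalH evalH evalH (inducedH f hf) opH := fun c d => by
  refine algHom_ext_of_comp_proj ?_
  rw [evalH_comp_proj, hop, ← dualOnPoints_of_isDualTo h, AlgHom.comp_assoc,
    inducedH, liftH_comp_proj, ← AlgHom.comp_assoc, pairEval_map, evalH_comp_proj,
    evalH_comp_proj]

theorem inducedH_mem {f : B m →ₐ[ℝ] B m ⊗[ℝ] B m}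
    (hf : ∀ j, (Algebra.TensorProduct.map (proj m) (proj m)).comp f (coord j []) = 1)
    (hdeg : ∀ n, ∀ x ∈ gradeB m n, f x ∈ tensorDegree (gradeB m) (gradeB m) n) (n : ℕ) (y : H m)
    (hy : y ∈ gradeH m n) : inducedH f hf y ∈ tensorDegree (gradeH m) (gradeH m) n := by
  obtain ⟨x, hx, rfl⟩ := hy
  have h := map_mem_tensorDegree (𝒜' := gradeH m) (𝒞' := gradeH m) (proj m).toLinearMap
    (proj m).toLinearMap (fun n a ha => Submodule.mem_map_of_mem ha)
    (fun n a ha => Submodule.mem_map_of_mem ha) (hdeg n x hx)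
  exact (inducedH_proj f hf x).symm ▸ h

theorem comulShuffle_coord_nil (j : Fin m) :
    comulShuffle m (coord j []) = coord j [] ⊗ₜ[ℝ] coord j [] := by
  simp [comulShuffle_coord, unshuffle]

theorem coactionMix_coord_nil (j : Fin m) : coactionMix m (coord j []) = coord j [] ⊗ₜ[ℝ] 1 := by
  have : wordsUpTo m 0 = {[]} := by ext η; simp [wordsUpTo]
  simp [coactionMix_coord, this, wordMixPoly]

theorem comulStar_coord_nil (j : Fin m) :
    comulStar m (coord j []) = coord j [] ⊗ₜ[ℝ] coord j [] := by
  simp [comulStar_coord, unshuffle, coactionMix_coord_nil]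

theorem map_proj_comulShuffle_coord_nil (j : Fin m) :
    (Algebra.TensorProduct.map (proj m) (proj m)).comp (comulShuffle m) (coord j []) = 1 := by
  rw [AlgHom.comp_apply, comulShuffle_coord_nil, Algebra.TensorProduct.map_tmul, proj_coord_nil]; rfl

theorem map_proj_coactionMix_coord_nil (j : Fin m) :
    (Algebra.TensorProduct.map (proj m) (proj m)).comp (coactionMix m) (coord j []) = 1 := by
  rw [AlgHom.comp_apply, coactionMix_coord_nil, Algebra.TensorProduct.map_tmul, proj_coord_nil, map_one]; rfl

theorem map_proj_comulStar_coord_nil (j : Fin m) :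
    (Algebra.TensorProduct.map (proj m) (proj m)).comp (comulStar m) (coord j []) = 1 := by
  rw [AlgHom.comp_apply, comulStar_coord_nil, Algebra.TensorProduct.map_tmul, proj_coord_nil]; rfl

/-! ### The grading of `𝓗` -/

theorem substOne_mem (n : ℕ) (x : B m) (hx : x ∈ gradeB m n) : substOne m x ∈ gradeB m n := by
  have := gradedMonoid_gradeB (m := m)
  refine algHom_mem_of_isWeightedHomogeneous _ (substOne m) (fun ⟨j, η⟩ => ?_) hx
  change substOne m (coord j η) ∈ gradeB m η.length
  rw [substOne_coord]
  split_ifs with h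
  · rw [h]; exact SetLike.GradedOne.one_mem
  · exact coord_mem j η

theorem isAlgebraGrading_gradeH : IsAlgebraGrading (gradeH m) where
  isInternal := isInternal_map_of_section isAlgebraGrading_gradeB.isInternal
    (proj m).toLinearMap (sectionH m).toLinearMap proj_sectionH fun n x hx => by
      have := substOne_mem n x hx
      rwa [← sectionH_proj] at this
  gradedMonoid :=
    have := gradedMonoid_gradeB (m := m)
    { one_mem := ⟨1, SetLike.GradedOne.one_mem, map_one (proj m)⟩
      mul_mem := by
        rintro i j _ _ ⟨a, ha, rfl⟩ ⟨b, hb, rfl⟩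
        exact ⟨a * b, SetLike.GradedMul.mul_mem ha hb, map_mul (proj m) a b⟩ }

/-- The submodule of `𝓗` that is `ℝ 1` in degree `0` and everything in the other degrees. -/
noncomputable def scalarsInDegreeZero (m n : ℕ) : Submodule ℝ (H m) := if n = 0 then Submodule.span ℝ {1} else ⊤

/-- `𝓗` is connected: an element of degree `0` is a polynomial in the `a^j_1`. -/
theorem gradeH_zero : gradeH m 0 = Submodule.span ℝ {1} := by
  apply le_antisymm
  · rintro _ ⟨x, hx, rfl⟩
    have : SetLike.GradedMonoid (scalarsInDegreeZero m) :=
      { one_mem := by simp [scalarsInDegreeZero, Submodule.mem_span_singleton_self]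
        mul_mem := fun i j a b ha hb => by
          by_cases hi : i = 0
          · by_cases hj : j = 0
            · simp only [scalarsInDegreeZero, hi, hj, if_true, add_zero,
                Submodule.mem_span_singleton] at ha hb ⊢
              obtain ⟨r, rfl⟩ := ha
              obtain ⟨s, rfl⟩ := hb
              exact ⟨r * s, by rw [smul_mul_smul_comm, one_mul]⟩
            · simp [scalarsInDegreeZero, hj]
          · simp [scalarsInDegreeZero, hi] }
    have h := algHom_mem_of_isWeightedHomogeneous (scalarsInDegreeZero m) (proj m)
      (fun ⟨j, η⟩ => ?_) hx
    · simpa [scalarsInDegreeZero] using h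
    · cases η with
      | nil =>
        change proj m (coord j []) ∈ Submodule.span ℝ {1}
        rw [proj_coord_nil]
        exact Submodule.mem_span_singleton_self 1
      | cons x η => simp [scalarsInDegreeZero]
  · rw [Submodule.span_le, Set.singleton_subset_iff]
    exact isAlgebraGrading_gradeH.gradedMonoid.one_mem

/-! ### The comodule Hopf algebra `𝓗` -/

/-- The counit of `𝓗`. -/
noncomputable def counitH (m : ℕ) : H m →ₐ[ℝ] ℝ := evalH ⟨vone m, fun _ => rfl⟩

theorem counitH_eq_zero (n : ℕ) (hn : n ≠ 0) (y : H m) (hy : y ∈ gradeH m n) :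
    counitH m y = 0 := by
  obtain ⟨x, hx, rfl⟩ := hy
  exact (AlgHom.congr_fun (evalH_comp_proj _) x).trans (counitB_eq_zero n hn x hx)

/-- The comultiplication of `𝓗` induced by `comulShuffle`. -/
noncomputable def comulShuffleH (m : ℕ) : H m →ₐ[ℝ] H m ⊗[ℝ] H m :=
  inducedH (comulShuffle m) map_proj_comulShuffle_coord_nil

/-- The comultiplication of `𝓗` induced by `comulStar`. -/
noncomputable def comulStarH (m : ℕ) : H m →ₐ[ℝ] H m ⊗[ℝ] H m :=
  inducedH (comulStar m) map_proj_comulStar_coord_nil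

/-- The coaction of `𝓗` induced by `coactionMix`. -/
noncomputable def coactionMixH (m : ℕ) : H m →ₐ[ℝ] H m ⊗[ℝ] H m :=
  inducedH (coactionMix m) map_proj_coactionMix_coord_nil

theorem vshuffle_nil (c d : VSeries m) (j : Fin m) : vshuffle c d j [] = c j [] * d j [] :=
  shuffle_nil _ _

theorem vmix_nil (c d : VSeries m) (j : Fin m) : vmix c d j [] = c j [] := mix_nil _ _

theorem isRightGradedComoduleHopfAlgebra_H :
    IsRightGradedComoduleHopfAlgebra (gradeH m) (gradeH m) (comulShuffleH m) (counitH m)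
      (comulStarH m) (counitH m) (coactionMixH m) := by
  let sh (c d : UnitSeries m) : UnitSeries m :=
    ⟨vshuffle c.1 d.1, fun j => by rw [vshuffle_nil, c.2, d.2, one_mul]⟩
  let mx (c d : UnitSeries m) : UnitSeries m :=
    ⟨vmix c.1 d.1, fun j => by rw [vmix_nil, c.2]⟩
  let st (c d : UnitSeries m) : UnitSeries m :=
    ⟨star c.1 d.1, fun j => by rw [star, vshuffle_nil, vmix_nil, c.2, d.2, one_mul]⟩
  have hδ : DualOnPoints evalH evalH evalH (comulShuffleH m) sh :=
    dualOnPoints_inducedH isDualTo_comulShuffle _ fun _ _ => rfl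
  have hΔ : DualOnPoints evalH evalH evalH (comulStarH m) st :=
    dualOnPoints_inducedH isDualTo_comulStar _ fun _ _ => rfl
  have hρ : DualOnPoints evalH evalH evalH (coactionMixH m) mx :=
    dualOnPoints_inducedH isDualTo_coactionMix _ fun _ _ => rfl
  have hsep := separates_evalH (m := m)
  refine IsRightGradedComoduleBialgebra.isRightGradedComoduleHopfAlgebra ?_ gradeH_zero gradeH_zero
  exact
  { bialgebra :=
      { toIsAlgebraGrading := isAlgebraGrading_gradeH
        toIsBialgebra := isBialgebra_of_points hsep hδ
          (fun _ _ _ => Subtype.ext (vshuffle_assoc _ _ _))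
          (fun _ => Subtype.ext (vone_vshuffle _)) (fun _ => Subtype.ext (vshuffle_vone _))
        comul_mem := inducedH_mem _ comulShuffle_mem
        counit_eq_zero := counitH_eq_zero }
    bialgebra_coacting :=
      { toIsAlgebraGrading := isAlgebraGrading_gradeH
        toIsBialgebra := isBialgebra_of_points hsep hΔ
          (fun _ _ _ => Subtype.ext (star_assoc _ _ _))
          (fun _ => Subtype.ext (vone_star _)) (fun _ => Subtype.ext (star_vone _))
        comul_mem := inducedH_mem _ comulStar_mem
        counit_eq_zero := counitH_eq_zero }
    coaction := isRightCoaction_of_points hsep hsep hΔ hρ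
      (fun _ _ _ => Subtype.ext (vmix_vmix _ _ _)) (fun _ => Subtype.ext (vmix_vone _))
    coaction_mem := inducedH_mem _ coactionMix_mem
    comul_comodule := comul_comodule_of_points hsep hsep hδ hρ
      (fun _ _ _ => Subtype.ext (vshuffle_vmix _ _ _))
    counit_comodule := counit_comodule_of_points hsep hρ (fun _ => Subtype.ext (vone_vmix _)) }

end AlgebraH

end MultFeedback

theorem mainTheorem8 (m : ℕ) :
    -- `δ`, `Δ` and `ρ` are the unique algebra maps dual to shuffle, `⋆` and `↶`
    ∃ δ Δ ρ : MultFeedback.B m →ₐ[ℝ] MultFeedback.B m ⊗[ℝ] MultFeedback.B m,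
      (∀ f, MultFeedback.IsDualTo f MultFeedback.vshuffle ↔ f = δ) ∧
      (∀ f, MultFeedback.IsDualTo f MultFeedback.star ↔ f = Δ) ∧
      (∀ f, MultFeedback.IsDualTo f MultFeedback.vmix ↔ f = ρ) ∧
      MultFeedback.IsRightGradedComoduleBialgebra (MultFeedback.gradeB m) (MultFeedback.gradeB m)
        δ (MultFeedback.counitB m) Δ (MultFeedback.counitB m) ρ ∧
      -- they and the counit descend to the quotient
      ∃ (δH ΔH ρH : MultFeedback.H m →ₐ[ℝ] MultFeedback.H m ⊗[ℝ] MultFeedback.H m)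
        (νH : MultFeedback.H m →ₐ[ℝ] ℝ),
        (∀ g, MultFeedback.IsInducedBy g δ ↔ g = δH) ∧
        (∀ g, MultFeedback.IsInducedBy g Δ ↔ g = ΔH) ∧
        (∀ g, MultFeedback.IsInducedBy g ρ ↔ g = ρH) ∧
        (∀ g : MultFeedback.H m →ₐ[ℝ] ℝ,
          g.comp (MultFeedback.proj m) = MultFeedback.counitB m ↔ g = νH) ∧
        MultFeedback.gradeH m 0 = Submodule.span ℝ {1} ∧
        MultFeedback.IsRightGradedComoduleHopfAlgebra (MultFeedback.gradeH m)
          (MultFeedback.gradeH m) δH νH ΔH νH ρH := by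
  open MultFeedback in
  exact ⟨comulShuffle m, comulStar m, coactionMix m, isDualTo_iff isDualTo_comulShuffle,
    isDualTo_iff isDualTo_comulStar, isDualTo_iff isDualTo_coactionMix,
    isRightGradedComoduleBialgebra_B, comulShuffleH m, comulStarH m, coactionMixH m, counitH m,
    isInducedBy_iff _ _, isInducedBy_iff _ _, isInducedBy_iff _ _,
    comp_proj_eq_iff (evalAt (vone m)) fun j => evalAt_coord _ j [], gradeH_zero, isRightGradedComoduleHopfAlgebra_H⟩
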